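/- Let $F(X)$ denote the free group on a set $X$ (of any cardinality, not necessarily finite), and let the \emph{reduced free group} $\widehat F(X)$ be the quotient of $F(X)$ by the relations $[x, gxg^{-1}]=1$ for all $x\in X$ and all $g\in F(X)$, where $[a,b]=aba^{-1}b^{-1}$. An \emph{almost-direct product of free groups} (respectively, \emph{of reduced free groups}) is a group $G$ isomorphic to an iterated semidirect product $$L_\ell\rtimes_{\alpha_\ell}\bigl(L_{\ell-1}\rtimes_{\alpha_{\ell-1}}(\cdots\rtimes_{\alpha_3}(L_2\rtimes_{\alpha_2}L_1)\cdots)\bigr),\qquad \ell\ge 1,$$ in which every $L_i$ is a free group (respectively, every $L_i$ is a reduced free group), not necessarily finitely generated, and for each $2\le k\le\ell$ the action $\alpha_k$ of $L_{k-1}\rtimes(\cdots\rtimes L_1)$ on $L_k$ induces the trivial action on the abelianization $H_1(L_k,\mathbb Z)=L_k/[L_k,L_k]$. A group $G$ \emph{has generalized torsion} if there are $g\in G$ with $g\ne 1$, an integer $k\ge 1$ and $h_1,\dots,h_k\in G$ such that $(h_1gh_1^{-1})(h_2gh_2^{-1})\cdots(h_kgh_k^{-1})=1$. It is \emph{residually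 nilpotent} if for every $g\ne 1$ in $G$ there is a normal subgroup $N$ of $G$ with $g\notin N$ and $G/N$ nilpotent. \textbf{Corollary.} Let $G$ be an almost-direct product of free groups or an almost-direct product of reduced free groups. Then $G$ is residually nilpotent and has no generalized torsion; in particular $G$ is torsion-free, that is, it has no nontrivial element of finite order. Furthermore, the group ring $\mathbb ZG$ embeds in a division algebra: there are a division ring $D$ that is an algebra over $\mathbb Q$ and an injective ring homomorphism $\mathbb ZG\to D$. -/

import Mathlib

open scoped commutatorElement

universe u

/-- The reduced free group on the set `X` of generators: the quotient of the free group on `X` by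
the relations `[x, g x g⁻¹] = 1` for all generators `x` and all elements `g` of the free group. -/
abbrev ReducedFreeGroup (X : Type u) : Type u :=
  PresentedGroup {r : FreeGroup X | ∃ (x : X) (g : FreeGroup X),
    r = ⁅FreeGroup.of x, g * FreeGroup.of x * g⁻¹⁆}

/-- `L` is a reduced free group, of arbitrary (possibly infinite) rank. -/
def IsReducedFreeGroup (L : Type u) [Group L] : Prop :=
  ∃ X : Type u, Nonempty (L ≃* ReducedFreeGroup X)

/-- The action `α` of `Q` on `L` induces the trivial action on the abelianization of `L`. -/
def ActsTriviallyOnAbelianization {L Q : Type u} [Group L] [Group Q] (α : Q →* MulAut L) : Prop :=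
  ∀ q : Q, Abelianization.map (α q).toMonoidHom = MonoidHom.id (Abelianization L)

/-- `G` is (isomorphic to) an iterated semidirect product
`L_ℓ ⋊ (L_{ℓ-1} ⋊ (⋯ (L_2 ⋊ L_1) ⋯))`, `ℓ ≥ 1`, of groups `L_i` satisfying `P`,
in which, for every `k`, the group `L_{k-1} ⋊ (⋯ (L_2 ⋊ L_1) ⋯)` acts trivially on the
abelianization of `L_k`. -/
inductive IsAlmostDirectProductOf (P : ∀ (L : Type u) [Group L], Prop) :
    ∀ (G : Type u) [Group G], Prop
  | factor (G : Type u) [Group G] (hG : P G) : IsAlmostDirectProductOf P G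
  | semidirect (L Q G : Type u) [Group L] [Group Q] [Group G] (α : Q →* MulAut L)
      (hL : P L) (hQ : IsAlmostDirectProductOf P Q) (hα : ActsTriviallyOnAbelianization α)
      (e : G ≃* L ⋊[α] Q) : IsAlmostDirectProductOf P G

/-- Every nontrivial element of `G` survives in some nilpotent quotient of `G`. -/
def IsResiduallyNilpotent (G : Type u) [Group G] : Prop :=
  ∀ g : G, g ≠ 1 → ∃ (N : Subgroup G) (_ : N.Normal), Group.IsNilpotent (G ⧸ N) ∧ g ∉ N

/-- Some nonempty finite product of conjugates of a nontrivial element of `G` is trivial. -/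
def HasGeneralizedTorsion (G : Type u) [Group G] : Prop :=
  ∃ g : G, g ≠ 1 ∧ ∃ l : List G, l ≠ [] ∧ (l.map fun h => h * g * h⁻¹).prod = 1

/-! Everything rests on one property of a group `L`, `IsAugSeparated`: the powers of the
augmentation ideal I of ℚL separate the elements of `L` from 1. An automorphism trivial on the
abelianization acts trivially on each quotient I^n/I^(n+1) (`IsIA.map_sub_mem`), and this has two
consequences.

Residual nilpotence: `L ⋊ Q` acts on ℚL, with `L` acting by left multiplication and `Q` by
automorphisms. Each element moves I^n into I^(n+1), so deep terms of the lower central series move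
the vector 1 by very little, whereas l ≠ 1 in `L` moves it by l - 1. Elements outside `L` are
detected in `Q`.

Orderability: the sign of g - 1 in the first quotient I^n/I^(n+1) where it survives gives a
bi-invariant order on `L` preserved by such automorphisms (`IsAugSeparated.exists_isPositiveCone`).
These orders combine lexicographically along the semidirect products. A bi-ordered group has no
generalized torsion, and its integral group ring embeds in the division ring of Malcev–Neumann
series over ℚ.

It remains to separate the two kinds of factors. A generator x acts on the span of words by 1 +
`prepend` x, where inadmissible words are set to 0. For free groups adjacent letters must differ,
and the coefficients of a reduced product of syllables show faithfulness
(`FreeGroup.isAugSeparated`). For reduced free groups all letters must be distinct; the image of the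
empty word determines g · (`kill {x}` g)⁻¹ for every x, hence detects whether g = 1
(`ReducedFreeGroup.mk_eq_one_of_nodupRep`). -/

/-! ### Well-ordered subsets of an ordered group. -/

section WellOrderedSets

variable {G : Type*} [Group G] [LinearOrder G] [MulLeftMono G] [MulRightMono G]

/-- Infinitely many solutions would give a strictly increasing sequence of left factors, hence a
strictly decreasing sequence of right factors in `T`. -/
theorem Set.IsPWO.finite_mulAntidiagonal {S T : Set G} (hS : S.IsPWO) (hT : T.IsPWO) (c : G) :
    {a | a ∈ S ∧ a⁻¹ * c ∈ T}.Finite := by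
  by_contra hinf
  set e := Set.Infinite.natEmbedding _ hinf
  obtain ⟨g, hg⟩ := hS.exists_monotone_subseq (f := fun n => (e n : G)) fun n => (e n).2.1
  obtain ⟨m, n, hmn, hle⟩ := hT.exists_lt (f := fun n => (e (g n) : G)⁻¹ * c)
    fun n => (e (g n)).2.2
  have h1 : (e (g m) : G) < e (g n) := by
    refine lt_of_le_of_ne (hg hmn.le) fun h => ?_
    exact hmn.ne (g.injective (e.injective (Subtype.ext h)))
  have h2 : (e (g n) : G) ≤ e (g m) := by
    have h3 : (e (g m) : G)⁻¹ ≤ (e (g n) : G)⁻¹ := le_of_mul_le_mul_right' hle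
    exact inv_le_inv_iff.1 h3
  exact absurd h1 (not_lt.2 h2)

theorem Set.IsPWO.image2_mul {S T : Set G} (hS : S.IsPWO) (hT : T.IsPWO) :
    (Set.image2 (· * ·) S T).IsPWO := by
  rw [← Set.image_prod]
  exact (hS.prod hT).image_of_monotone fun a b h => mul_le_mul' h.1 h.2

/-- Neumann's lemma, for a linearly ordered group. -/
theorem Set.IsPWO.closure_of_one_le {S : Set G} (hpos : ∀ x ∈ S, 1 ≤ x) (h : S.IsPWO) :
    (Submonoid.closure S : Set G).IsPWO := by
  rw [Submonoid.closure_eq_image_prod]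
  refine (h.partiallyWellOrderedOn_sublistForall₂ (· ≤ ·)).image_of_monotone_on ?_
  exact fun l1 _ l2 hl2 h12 => h12.prod_le_prod' fun x hx => hpos x <| hl2 x hx

end WellOrderedSets

/-! ### The division ring of Malcev–Neumann series. -/

/-- The Malcev–Neumann series over `k` on the ordered group `G`: the functions with well-ordered
support. -/
def MalcevNeumann (k G : Type*) [DivisionRing k] [LinearOrder G] : Type _ :=
  {f : G → k // (Function.support f).IsPWO}

namespace MalcevNeumann

section AddGroup

variable {k G : Type*} [DivisionRing k] [LinearOrder G]

instance : FunLike (MalcevNeumann k G) G k where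
  coe := Subtype.val
  coe_injective := Subtype.val_injective

theorem isPWO_support (f : MalcevNeumann k G) : (Function.support f).IsPWO := f.2

@[ext]
theorem ext {f g : MalcevNeumann k G} (h : ∀ a, f a = g a) : f = g := DFunLike.ext _ _ h

instance : Zero (MalcevNeumann k G) := ⟨⟨0, by simp⟩⟩

instance : Add (MalcevNeumann k G) :=
  ⟨fun f g => ⟨f + g, (f.isPWO_support.union g.isPWO_support).mono (Function.support_add _ _)⟩⟩

instance : Neg (MalcevNeumann k G) :=
  ⟨fun f => ⟨-f, by rw [Function.support_neg]; exact f.isPWO_support⟩⟩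

@[simp] theorem zero_apply (a : G) : (0 : MalcevNeumann k G) a = 0 := rfl
@[simp] theorem add_apply (f g : MalcevNeumann k G) (a : G) : (f + g) a = f a + g a := rfl
@[simp] theorem neg_apply (f : MalcevNeumann k G) (a : G) : (-f) a = -f a := rfl

instance : AddCommGroup (MalcevNeumann k G) where
  add_assoc _ _ _ := by ext; simp [add_assoc]
  zero_add _ := by ext; simp
  add_zero _ := by ext; simp
  add_comm _ _ := by ext; simp [add_comm]
  neg_add_cancel _ := by ext; simp
  nsmul := nsmulRec
  zsmul := zsmulRec

@[simp] theorem sub_apply (f g : MalcevNeumann k G) (a : G) : (f - g) a = f a - g a := by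
  rw [sub_eq_add_neg, sub_eq_add_neg, add_apply, neg_apply]

open Classical in
/-- The series with the single coefficient `c`, at `g`. -/
noncomputable def single (g : G) (c : k) : MalcevNeumann k G :=
  ⟨Pi.single g c, (Set.finite_singleton g).isPWO.mono Pi.support_single_subset⟩

theorem single_same (g : G) (c : k) : single g c g = c := by
  classical exact Pi.single_eq_same (M := fun _ : G => k) g c

theorem single_of_ne {g a : G} (h : a ≠ g) (c : k) : single g c a = 0 := by
  classical exact Pi.single_eq_of_ne (M := fun _ : G => k) h c

end AddGroup

variable {k G : Type*} [DivisionRing k] [Group G] [LinearOrder G] [MulLeftMono G] [MulRightMono G]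

theorem finite_support_mul (f g : MalcevNeumann k G) (c : G) :
    (Function.support fun a => f a * g (a⁻¹ * c)).Finite :=
  (f.isPWO_support.finite_mulAntidiagonal g.isPWO_support c).subset fun _ ha =>
    ⟨left_ne_zero_of_mul ha, right_ne_zero_of_mul ha⟩

noncomputable instance : Mul (MalcevNeumann k G) where
  mul f g := ⟨fun c => ∑ᶠ a, f a * g (a⁻¹ * c),
    (f.isPWO_support.image2_mul g.isPWO_support).mono fun c hc => by
      obtain ⟨a, ha⟩ : ∃ a, f a * g (a⁻¹ * c) ≠ 0 := by
        by_contra! h0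
        exact hc (finsum_eq_zero_of_forall_eq_zero h0)
      exact ⟨a, left_ne_zero_of_mul ha, a⁻¹ * c, right_ne_zero_of_mul ha, by simp⟩⟩

theorem mul_apply (f g : MalcevNeumann k G) (c : G) :
    (f * g) c = ∑ᶠ a, f a * g (a⁻¹ * c) := rfl

theorem single_mul_apply (g : G) (c : k) (f : MalcevNeumann k G) (a : G) :
    (single g c * f) a = c * f (g⁻¹ * a) := by
  rw [mul_apply, finsum_eq_single _ g fun x hx => by rw [single_of_ne hx, zero_mul], single_same]

theorem mul_single_apply (g : G) (c : k) (f : MalcevNeumann k G) (a : G) :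
    (f * single g c) a = f (a * g⁻¹) * c := by
  rw [mul_apply, finsum_eq_single _ (a * g⁻¹) fun x hx => ?_]
  · simp [single_same]
  · rw [single_of_ne, mul_zero]
    rintro rfl
    simp at hx

protected theorem mul_assoc' (f g h : MalcevNeumann k G) : f * g * h = f * (g * h) := by
  ext d
  have hfin : (Function.support fun p : G × G =>
      f p.1 * g (p.1⁻¹ * p.2) * h (p.2⁻¹ * d)).Finite := by
    have h1 := (f.isPWO_support.image2_mul g.isPWO_support).finite_mulAntidiagonal
      h.isPWO_support d
    refine (h1.biUnion fun e _ => ((finite_support_mul f g e).image fun a => (a, e))).subset ?_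
    rintro ⟨a, e⟩ hp
    have hp1 := left_ne_zero_of_mul hp
    simp only [Set.mem_iUnion, Set.mem_image]
    exact ⟨e, ⟨⟨a, left_ne_zero_of_mul hp1, _, right_ne_zero_of_mul hp1, by simp⟩,
      right_ne_zero_of_mul hp⟩, a, hp1, rfl⟩
  calc (f * g * h) d = ∑ᶠ e, ∑ᶠ a, f a * g (a⁻¹ * e) * h (e⁻¹ * d) := by
        rw [mul_apply]
        exact finsum_congr fun e => by rw [mul_apply, finsum_mul' _ _ (finite_support_mul f g e)]
    _ = ∑ᶠ p : G × G, f p.2 * g (p.2⁻¹ * p.1) * h (p.1⁻¹ * d) :=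
        (finsum_curry (fun p : G × G => f p.2 * g (p.2⁻¹ * p.1) * h (p.1⁻¹ * d))
          (hfin.preimage (f := Prod.swap) Prod.swap_injective.injOn)).symm
    _ = ∑ᶠ p : G × G, f p.1 * g (p.1⁻¹ * p.2) * h (p.2⁻¹ * d) :=
        finsum_comp_equiv (Equiv.prodComm G G)
          (f := fun p : G × G => f p.1 * g (p.1⁻¹ * p.2) * h (p.2⁻¹ * d))
    _ = ∑ᶠ a, ∑ᶠ e, f a * g (a⁻¹ * e) * h (e⁻¹ * d) := finsum_curry _ hfin
    _ = (f * (g * h)) d := by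
        rw [mul_apply]
        refine finsum_congr fun a => ?_
        rw [mul_apply, mul_finsum' _ _ (finite_support_mul g h _),
          ← finsum_comp_equiv (Equiv.mulLeft a)]
        exact finsum_congr fun e => by simp [mul_assoc]

noncomputable instance : One (MalcevNeumann k G) := ⟨single 1 1⟩

omit [MulLeftMono G] [MulRightMono G] in
theorem one_def : (1 : MalcevNeumann k G) = single 1 1 := rfl

noncomputable instance : Ring (MalcevNeumann k G) where
  zsmul := zsmulRec
  neg_add_cancel := neg_add_cancel
  left_distrib f g h := by
    ext c
    simp only [mul_apply, add_apply, mul_add]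
    exact finsum_add_distrib (finite_support_mul f g c) (finite_support_mul f h c)
  right_distrib f g h := by
    ext c
    simp only [mul_apply, add_apply, add_mul]
    exact finsum_add_distrib (finite_support_mul f h c) (finite_support_mul g h c)
  zero_mul f := by ext c; simp [mul_apply]
  mul_zero f := by ext c; simp [mul_apply]
  mul_assoc := MalcevNeumann.mul_assoc'
  one_mul f := by ext c; simp [one_def, single_mul_apply]
  mul_one f := by ext c; simp [one_def, mul_single_apply]

open Classical in
/-- A series `h` supported on elements larger than `1` has a geometric series. -/
theorem exists_one_sub_mul_eq_one (h : MalcevNeumann k G) (hh : ∀ a, h a ≠ 0 → 1 < a) :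
    ∃ u : MalcevNeumann k G, (1 - h) * u = 1 := by
  set S := Submonoid.closure (Function.support h) with hS
  have hSP : (S : Set G).IsPWO :=
    h.isPWO_support.closure_of_one_le fun x hx => (hh x hx).le
  have wf : WellFounded fun x y : S => x < y := hSP.isWF
  have hlt : ∀ {a x : G}, 1 < a → a⁻¹ * x < x := fun ha => by simpa using ha
  -- The geometric series is not summed: its coefficients solve u = 1 + h * u, a recursion along the
  -- well-ordered set `S` because a⁻¹ * x < x when 1 < a.
  let F : ∀ x : S, (∀ y : S, y < x → k) → k := fun x rec =>
    (1 : MalcevNeumann k G) x + ∑ᶠ a : G,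
      if H : 1 < a ∧ a⁻¹ * (x : G) ∈ S then h a * rec ⟨a⁻¹ * x, H.2⟩ (hlt H.1) else 0
  let v : G → k := fun g => if hg : g ∈ S then wf.fix F ⟨g, hg⟩ else 0
  have hv : ∀ g, v g ≠ 0 → g ∈ S := fun g hg => by
    by_contra hgS
    exact hg (dif_neg hgS)
  let u : MalcevNeumann k G := ⟨v, hSP.mono fun g hg => hv g hg⟩
  have hu : ∀ g, u g = v g := fun _ => rfl
  refine ⟨u, ?_⟩
  suffices u = 1 + h * u by rw [sub_mul, one_mul, sub_eq_iff_eq_add]; exact this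
  ext g
  rw [add_apply, mul_apply]
  by_cases hg : g ∈ S
  · have : u g = F ⟨g, hg⟩ fun y _ => wf.fix F y := by
      rw [hu]
      simp only [v, dif_pos hg]
      exact wf.fix_eq F _
    rw [this]
    simp only [F]
    congr 1
    refine finsum_congr fun a => ?_
    by_cases ha : h a = 0
    · simp [ha]
    by_cases ha' : a⁻¹ * g ∈ S
    · rw [dif_pos ⟨hh a ha, ha'⟩, hu, show v (a⁻¹ * g) = wf.fix F ⟨a⁻¹ * g, ha'⟩ from dif_pos ha']
    · rw [dif_neg fun H => ha' H.2, hu]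
      simp only [v, dif_neg ha', mul_zero]
  · rw [hu, show v g = 0 from dif_neg hg, one_def,
      single_of_ne (by rintro rfl; exact hg S.one_mem), zero_add, eq_comm]
    refine finsum_eq_zero_of_forall_eq_zero fun a => ?_
    by_contra hne
    refine hg ?_
    have := S.mul_mem (Submonoid.subset_closure (left_ne_zero_of_mul hne))
      (hv _ (right_ne_zero_of_mul hne))
    simpa using this

/-- Multiplying by the inverse of the leading term turns `f` into 1 minus a series supported above
1. Right inverses suffice for a division ring. -/
theorem exists_mul_eq_one {f : MalcevNeumann k G} (hf : f ≠ 0) : ∃ u, f * u = 1 := by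
  have hne : (Function.support f).Nonempty := by
    by_contra h
    exact hf (ext fun a => by_contra fun ha => h ⟨a, ha⟩)
  obtain ⟨g, hg, hmin⟩ : ∃ g, f g ≠ 0 ∧ ∀ a, a < g → f a = 0 :=
    ⟨_, f.isPWO_support.isWF.min_mem hne, fun a ha => by
      by_contra h
      exact f.isPWO_support.isWF.not_lt_min hne h ha⟩
  set s : MalcevNeumann k G := single g⁻¹ (f g)⁻¹
  obtain ⟨u, hu⟩ := exists_one_sub_mul_eq_one (1 - f * s) fun a ha => by
    by_contra hlt
    apply ha
    rcases (not_lt.1 hlt).eq_or_lt with rfl | h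
    · simp [s, mul_single_apply, one_def, single_same, hg]
    · have : f (a * g) = 0 := hmin _ (by simpa using h)
      simp [s, mul_single_apply, one_def, single_of_ne h.ne, this]
  exact ⟨s * u, by rw [← mul_assoc]; simpa using hu⟩

instance : Nontrivial (MalcevNeumann k G) :=
  ⟨0, 1, fun h => by simpa [one_def, single_same] using DFunLike.congr_fun h (1 : G)⟩

open Classical in
noncomputable instance : DivisionRing (MalcevNeumann k G) where
  inv f := if hf : f = 0 then 0 else (exists_mul_eq_one hf).choose
  mul_inv_cancel f hf := by
    change f * dite _ _ _ = 1
    rw [dif_neg hf]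
    exact (exists_mul_eq_one hf).choose_spec
  inv_zero := dif_pos rfl
  nnqsmul := _
  nnqsmul_def := fun _ _ => rfl
  qsmul := _
  qsmul_def := fun _ _ => rfl

/-- The embedding of an ordered group in its Malcev–Neumann series. -/
noncomputable def of : G →* MalcevNeumann k G where
  toFun g := single g 1
  map_one' := rfl
  map_mul' a b := by
    ext c
    rw [single_mul_apply, one_mul]
    by_cases h : c = a * b
    · subst h; simp [single_same]
    · rw [single_of_ne h, single_of_ne fun h' => h (by rw [← h']; simp)]

theorem zsmul_apply (n : ℤ) (f : MalcevNeumann k G) (g : G) : (n • f) g = n • f g :=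
  map_zsmul (⟨⟨fun f => f g, rfl⟩, fun _ _ => rfl⟩ : MalcevNeumann k G →+ k) n f

theorem lift_of_apply (x : MonoidAlgebra ℤ G) (g : G) :
    MonoidAlgebra.lift ℤ (MalcevNeumann k G) G of x g = (x.coeff g : k) := by
  induction x using MonoidAlgebra.induction_on with
  | of a =>
    rw [MonoidAlgebra.lift_of]
    change single a 1 g = _
    by_cases h : g = a
    · subst h; simp [single_same]
    · simp [single_of_ne h, Finsupp.single_eq_of_ne h]
  | add x y hx hy => simp [hx, hy]
  | smul r x hx => rw [map_smul, zsmul_apply, hx, MonoidAlgebra.coeff_smul]; simp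

theorem lift_of_injective [CharZero k] :
    Function.Injective (MonoidAlgebra.lift ℤ (MalcevNeumann k G) G of) := by
  refine (injective_iff_map_eq_zero _).2 fun x hx => ?_
  ext g
  have := lift_of_apply (k := k) x g
  rw [hx] at this
  rw [zero_apply] at this
  exact_mod_cast this.symm

instance [CharZero k] : CharZero (MalcevNeumann k G) :=
  charZero_of_inj_zero fun n hn => by
    have h := DFunLike.congr_fun hn (1 : G)
    rw [← mul_one (n : MalcevNeumann k G), ← nsmul_eq_mul, ← natCast_zsmul, zsmul_apply, one_def,
      single_same] at h
    simpa using h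

end MalcevNeumann

/-! ### Lower central series and filtered representations. -/

section ResidualNilpotence

variable {G : Type*} [Group G] {A : Type*} [AddCommGroup A]

theorem addMonoidEnd_map_mul_apply (ρ : G →* AddMonoid.End A) (a b : G) (x : A) :
    ρ (a * b) x = ρ a (ρ b x) := by
  rw [map_mul]; rfl

/-- The elements of `G` which shift the filtration `F` by `n`. -/
def filtrationShift (ρ : G →* AddMonoid.End A) (F : ℕ → AddSubgroup A) (hF : Antitone F)
    (h : ∀ g k, ∀ x ∈ F k, ρ g x - x ∈ F (k + 1)) (n : ℕ) : Subgroup G where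
  carrier := {g | ∀ k, ∀ x ∈ F k, ρ g x - x ∈ F (k + n)}
  one_mem' k x _ := by simp
  mul_mem' {a b} ha hb k x hx := by
    have hbx : ρ b x ∈ F k := by
      simpa using add_mem (hF (Nat.le_succ k) (h b k x hx)) hx
    simpa using add_mem (ha k _ hbx) (hb k x hx)
  inv_mem' {a} ha k x hx := by
    have hax : ρ a⁻¹ x ∈ F k := by
      simpa using add_mem (hF (Nat.le_succ k) (h a⁻¹ k x hx)) hx
    have e : ρ a (ρ a⁻¹ x) = x := by
      rw [← addMonoidEnd_map_mul_apply]; simp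
    have := ha k _ hax
    rw [e] at this
    simpa using neg_mem this

/-- The shift subgroups form a descending central series, since ρ(ag) - ρ(ga) is the ring commutator
of ρ(a) - 1 and ρ(g) - 1, whose shifts add up. The series is indexed from 0, hence `n + 1`. -/
theorem lowerCentralSeries_le_filtrationShift (ρ : G →* AddMonoid.End A) (F : ℕ → AddSubgroup A)
    (hF : Antitone F) (h : ∀ g k, ∀ x ∈ F k, ρ g x - x ∈ F (k + 1)) (n : ℕ) :
    (⊤ : Subgroup G).lowerCentralSeries n ≤ filtrationShift ρ F hF h (n + 1) := by
  refine Subgroup.descending_central_series_ge_lower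
    (fun n => filtrationShift ρ F hF h (n + 1)) ⟨?_, ?_⟩ n
  · exact eq_top_iff.2 fun g _ => h g
  · intro a n ha g k z hz
    -- Evaluating the commutator of a and g at ρ(ga)w gives ρ(ag)w and removes the inverses.
    obtain ⟨w, hw, rfl⟩ : ∃ w ∈ F k, ρ (g * a) w = z := by
      refine ⟨ρ (g * a)⁻¹ z, ?_, ?_⟩
      · simpa using add_mem (hF (Nat.le_succ k) (h (g * a)⁻¹ k z hz)) hz
      · rw [← addMonoidEnd_map_mul_apply]; simp
    have e : ρ (a * g * a⁻¹ * g⁻¹) (ρ (g * a) w) = ρ a (ρ g w) := by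
      rw [← addMonoidEnd_map_mul_apply, ← addMonoidEnd_map_mul_apply]
      congr 2
      group
    have h1 := ha (k + 1) _ (h g k w hw)
    have h2 := h g (k + (n + 1)) _ (ha k w hw)
    have e2 : ρ a (ρ g w) - ρ (g * a) w =
        (ρ a (ρ g w - w) - (ρ g w - w)) - (ρ g (ρ a w - w) - (ρ a w - w)) := by
      rw [addMonoidEnd_map_mul_apply, map_sub, map_sub]
      abel
    rw [commutatorElement_def, e, e2]
    refine sub_mem ?_ ?_
    · convert h1 using 2; omega
    · exact h2

theorem exists_notMem_lowerCentralSeries_of_filtration (ρ : G →* AddMonoid.End A)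
    (F : ℕ → AddSubgroup A) (hF : Antitone F) (h : ∀ g k, ∀ x ∈ F k, ρ g x - x ∈ F (k + 1))
    {g : G} {x : A} {n : ℕ} (hx : x ∈ F 0) (hg : ρ g x - x ∉ F n) :
    ∃ n, g ∉ (⊤ : Subgroup G).lowerCentralSeries n :=
  ⟨n, fun hgN => hg <| hF (by omega : n ≤ 0 + (n + 1))
    (lowerCentralSeries_le_filtrationShift ρ F hF h n hgN 0 x hx)⟩

theorem map_top_lowerCentralSeries_le {H : Type*} [Group H] (f : G →* H) (n : ℕ) :
    ((⊤ : Subgroup G).lowerCentralSeries n).map f ≤ (⊤ : Subgroup H).lowerCentralSeries n := by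
  rw [Subgroup.map_lowerCentralSeries]
  exact Subgroup.lowerCentralSeries_mono n le_top

theorem isResiduallyNilpotent_iff {G : Type u} [Group G] :
    IsResiduallyNilpotent G ↔ ∀ g : G, g ≠ 1 → ∃ n, g ∉ (⊤ : Subgroup G).lowerCentralSeries n := by
  refine forall₂_congr fun g _ => ⟨?_, ?_⟩
  · rintro ⟨N, hN, hnil, hg⟩
    obtain ⟨n, hn⟩ := Subgroup.nilpotent_iff_lowerCentralSeries.1 hnil
    refine ⟨n, fun hgn => hg ?_⟩
    have := map_top_lowerCentralSeries_le (QuotientGroup.mk' N) n (Subgroup.mem_map_of_mem _ hgn)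
    rw [hn, Subgroup.mem_bot] at this
    exact (QuotientGroup.eq_one_iff g).1 this
  · rintro ⟨n, hn⟩
    refine ⟨_, inferInstance, ?_, hn⟩
    rw [Subgroup.nilpotent_iff_lowerCentralSeries]
    refine ⟨n, ?_⟩
    have := Subgroup.map_lowerCentralSeries ⊤
      (QuotientGroup.mk' ((⊤ : Subgroup G).lowerCentralSeries n)) n
    rw [Subgroup.map_top_of_surjective _ (QuotientGroup.mk'_surjective _)] at this
    rw [← this, QuotientGroup.map_mk'_self]

theorem exists_notMem_lowerCentralSeries_of_map {H : Type*} [Group H] (f : G →* H) {g : G}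
    (hg : ∃ n, f g ∉ (⊤ : Subgroup H).lowerCentralSeries n) :
    ∃ n, g ∉ (⊤ : Subgroup G).lowerCentralSeries n :=
  hg.imp fun n hn hgn => hn (map_top_lowerCentralSeries_le f n (Subgroup.mem_map_of_mem _ hgn))

end ResidualNilpotence

/-! ### Powers of the augmentation ideal. -/

section AugmentationIdeal

open MonoidAlgebra

variable (L : Type*) [Group L]

/-- The augmentation ideal of the rational group algebra. -/
noncomputable def augIdeal : Ideal (MonoidAlgebra ℚ L) :=
  RingHom.ker (MonoidAlgebra.lift ℚ ℚ L 1)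

instance : (augIdeal L).IsTwoSided := by unfold augIdeal; infer_instance

/-- The powers of the augmentation ideal separate the elements of `L`; this says that `L` is
residually torsion-free nilpotent. -/
def IsAugSeparated : Prop := ∀ g : L, g ≠ 1 → ∃ n, of ℚ L g - 1 ∉ augIdeal L ^ n

variable {L}

theorem of_sub_one_mem_augIdeal (g : L) : of ℚ L g - 1 ∈ augIdeal L := by
  rw [augIdeal, RingHom.mem_ker, map_sub, lift_of, map_one]
  simp

theorem augIdeal_pow_antitone : Antitone fun n => augIdeal L ^ n :=
  fun _ _ h => Ideal.pow_le_pow_right h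

theorem mul_mem_augIdeal_pow {m n : ℕ} {x y : MonoidAlgebra ℚ L} (hx : x ∈ augIdeal L ^ m)
    (hy : y ∈ augIdeal L ^ n) : x * y ∈ augIdeal L ^ (m + n) := by
  rw [Ideal.IsTwoSided.pow_add]
  exact Ideal.mul_mem_mul hx hy

/-- An automorphism acting trivially on the abelianization. -/
def IsIA (φ : MulAut L) : Prop :=
  Abelianization.map φ.toMonoidHom = MonoidHom.id (Abelianization L)

/-- The ring endomorphism of the group algebra induced by a group automorphism. -/
noncomputable def groupAlgebraMap : MulAut L →* (MonoidAlgebra ℚ L →+* MonoidAlgebra ℚ L) where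
  toFun φ := mapDomainRingHom ℚ φ.toMonoidHom
  map_one' := by ext <;> simp
  map_mul' φ ψ := by ext <;> simp

theorem groupAlgebraMap_of (φ : MulAut L) (g : L) :
    groupAlgebraMap φ (of ℚ L g) = of ℚ L (φ g) := by
  simp [groupAlgebraMap]

/-- Modulo I² the map g ↦ g - 1 is a homomorphism to an additive group, so it kills commutators. -/
theorem of_sub_one_mem_augIdeal_sq {g : L} (hg : g ∈ commutator L) :
    of ℚ L g - 1 ∈ augIdeal L ^ 2 := by
  let S : Subgroup L :=
  { carrier := {g | of ℚ L g - 1 ∈ augIdeal L ^ 2}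
    one_mem' := by rw [Set.mem_ofPred, map_one, sub_self]; exact zero_mem _
    mul_mem' := fun {a b} ha hb => by
      rw [Set.mem_ofPred] at ha hb ⊢
      have := add_mem (Ideal.mul_mem_left _ (of ℚ L a) hb) ha
      simpa [mul_sub] using this
    inv_mem' := fun {a} ha => by
      rw [Set.mem_ofPred] at ha ⊢
      have := Ideal.mul_mem_left _ (-of ℚ L a⁻¹) ha
      rw [mul_sub, neg_mul, ← map_mul] at this
      rw [inv_mul_cancel, map_one] at this
      convert this using 1
      noncomm_ring }
  suffices commutator L ≤ S from this hg
  rw [commutator_eq_closure, Subgroup.closure_le]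
  rintro _ ⟨a, b, rfl⟩
  have h1 := sub_mem
    (mul_mem_augIdeal_pow (m := 1) (n := 1) (x := of ℚ L a - 1) (y := of ℚ L b - 1)
      ((Submodule.pow_one (augIdeal L)).ge (of_sub_one_mem_augIdeal a)) ((Submodule.pow_one (augIdeal L)).ge (of_sub_one_mem_augIdeal b)))
    (mul_mem_augIdeal_pow (m := 1) (n := 1) (x := of ℚ L b - 1) (y := of ℚ L a - 1)
      ((Submodule.pow_one (augIdeal L)).ge (of_sub_one_mem_augIdeal b)) ((Submodule.pow_one (augIdeal L)).ge (of_sub_one_mem_augIdeal a)))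
  have h2 := Ideal.mul_mem_right (of ℚ L (b * a)⁻¹) _ h1
  have e : of ℚ L ⁅a, b⁆ - 1 = ((of ℚ L a - 1) * (of ℚ L b - 1) -
      (of ℚ L b - 1) * (of ℚ L a - 1)) * of ℚ L (b * a)⁻¹ := by
    have e1 : (of ℚ L a - 1) * (of ℚ L b - 1) - (of ℚ L b - 1) * (of ℚ L a - 1) =
        of ℚ L (a * b) - of ℚ L (b * a) := by
      rw [map_mul, map_mul]; noncomm_ring
    rw [e1, sub_mul, ← map_mul, ← map_mul, mul_inv_cancel, map_one, commutatorElement_def]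
    simp [mul_assoc]
  change of ℚ L ⁅a, b⁆ - 1 ∈ augIdeal L ^ 2
  rwa [e]

theorem IsIA.div_mem_commutator {φ : MulAut L} (hφ : IsIA φ) (g : L) :
    g⁻¹ * φ g ∈ commutator L := by
  have h : Abelianization.of (φ g) = Abelianization.of g := by
    have := DFunLike.congr_fun hφ (Abelianization.of g)
    simpa using this
  rw [← Abelianization.ker_of, MonoidHom.mem_ker, map_mul, map_inv, h, inv_mul_cancel]

/-- Since φ(g) - g = g(g⁻¹φ(g) - 1) lies in I², φ moves all of ℚL by elements of I². The rule φ(ab)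
- ab = (φ(a) - a)φ(b) + a(φ(b) - b) then carries this through the powers. -/
theorem IsIA.map_sub_mem {φ : MulAut L} (hφ : IsIA φ) (n : ℕ) {x : MonoidAlgebra ℚ L}
    (hx : x ∈ augIdeal L ^ n) : groupAlgebraMap φ x - x ∈ augIdeal L ^ (n + 1) := by
  have h2 : ∀ x, groupAlgebraMap φ x - x ∈ augIdeal L ^ 2 := fun x => by
    induction x using MonoidAlgebra.induction_on with
    | of g =>
      have := Ideal.mul_mem_left _ (of ℚ L g)
        (of_sub_one_mem_augIdeal_sq (hφ.div_mem_commutator g))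
      rw [mul_sub, ← map_mul, mul_inv_cancel_left, mul_one] at this
      rwa [groupAlgebraMap_of]
    | add x y hx hy =>
      rw [map_add, add_sub_add_comm]
      exact add_mem hx hy
    | smul r x hx =>
      have : groupAlgebraMap φ (r • x) = r • groupAlgebraMap φ x := map_rat_smul _ r x
      rw [this, ← smul_sub]
      exact Submodule.smul_of_tower_mem _ r hx
  induction n generalizing x with
  | zero => exact augIdeal_pow_antitone one_le_two (h2 x)
  | succ n ih =>
    rw [Submodule.pow_succ] at hx
    refine Submodule.mul_induction_on hx (fun a ha b hb => ?_) fun a b ha hb => ?_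
    · have hb' : groupAlgebraMap φ b ∈ augIdeal L ^ 1 := by
        rw [Submodule.pow_one]
        have := add_mem (Ideal.pow_le_self two_ne_zero (h2 b)) hb
        simpa using this
      have := add_mem (mul_mem_augIdeal_pow (ih ha) hb') (mul_mem_augIdeal_pow (m := n) (n := 2) ha (h2 b))
      convert this using 1
      rw [map_mul]; noncomm_ring
    · rw [map_add, add_sub_add_comm]
      exact add_mem ha hb

theorem isIA_conj (g : L) : IsIA (MulAut.conj g) := by
  unfold IsIA
  ext x
  simp

/-- Each algebra element acts as its augmentation modulo the next filtration step, so I shifts by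
one. This bounds powers of I by means of a representation. -/
theorem lift_mem_of_mem_augIdeal_pow {V : Type*} [AddCommGroup V] [Module ℚ V]
    (ρ : L →* Module.End ℚ V) (F : ℕ → Submodule ℚ V) (hF : Antitone F)
    (h : ∀ g k, ∀ v ∈ F k, ρ g v - v ∈ F (k + 1)) (n : ℕ) {x : MonoidAlgebra ℚ L}
    (hx : x ∈ augIdeal L ^ n) (k : ℕ) {v : V} (hv : v ∈ F k) :
    MonoidAlgebra.lift ℚ _ L ρ x v ∈ F (k + n) := by
  have h1 : ∀ (x : MonoidAlgebra ℚ L) (k : ℕ), ∀ v ∈ F k,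
      MonoidAlgebra.lift ℚ _ L ρ x v - MonoidAlgebra.lift ℚ ℚ L 1 x • v ∈ F (k + 1) := by
    intro x k v hv
    induction x using MonoidAlgebra.induction_on with
    | of g => simpa using h g k v hv
    | add x y hx hy =>
      rw [map_add, map_add, add_smul, LinearMap.add_apply, add_sub_add_comm]
      exact add_mem hx hy
    | smul r x hx =>
      rw [map_smul, map_smul, smul_assoc, LinearMap.smul_apply, ← smul_sub]
      exact Submodule.smul_mem _ r hx
  induction n generalizing x k v with
  | zero =>
    have := add_mem (hF (Nat.le_succ k) (h1 x k v hv))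
      (Submodule.smul_mem _ (MonoidAlgebra.lift ℚ ℚ L 1 x) hv)
    simpa using this
  | succ n ih =>
    rw [Submodule.pow_succ] at hx
    refine Submodule.mul_induction_on hx (fun a ha b hb => ?_) fun a b ha hb => ?_
    · have hb' := h1 b k v hv
      rw [augIdeal, RingHom.mem_ker] at hb
      erw [hb] at hb'
      rw [zero_smul, sub_zero] at hb'
      rw [map_mul, Module.End.mul_apply]
      have := ih ha (k + 1) hb'
      convert this using 2; omega
    · rw [map_add, LinearMap.add_apply]
      exact add_mem ha hb

end AugmentationIdeal

/-! ### Residual nilpotence of semidirect products. -/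

section Semidirect

open MonoidAlgebra

variable {L Q : Type*} [Group L] [Group Q] {α : Q →* MulAut L}

/-- The action of `L ⋊ Q` on the group algebra of `L`, by left multiplication on `L` and by
automorphisms on `Q`. -/
noncomputable def semidirectAction (α : Q →* MulAut L) :
    L ⋊[α] Q →* AddMonoid.End (MonoidAlgebra ℚ L) where
  toFun p := (AddMonoidHom.mulLeft (of ℚ L p.left)).comp
    (groupAlgebraMap (α p.right)).toAddMonoidHom
  map_one' := by 
    ext x : 1
    change of ℚ L 1 * groupAlgebraMap (α 1) x = x
    rw [map_one, map_one, map_one, one_mul]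
    rfl
  map_mul' p q := by
    ext x : 1
    change of ℚ L (p.left * α p.right q.left) * groupAlgebraMap (α (p.right * q.right)) x =
      of ℚ L p.left * groupAlgebraMap (α p.right)
        (of ℚ L q.left * groupAlgebraMap (α q.right) x)
    rw [map_mul, map_mul, map_mul, map_mul, groupAlgebraMap_of, mul_assoc]
    rfl

theorem semidirectAction_apply (p : L ⋊[α] Q) (x : MonoidAlgebra ℚ L) :
    semidirectAction α p x = of ℚ L p.left * groupAlgebraMap (α p.right) x := rfl

/-- The element l moves the vector 1 by l - 1, which is outside some I^n. The shift hypothesis holds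
because (l, q) moves x by (l - 1)α_q(x) + (α_q(x) - x). -/
theorem IsAugSeparated.exists_notMem_lowerCentralSeries (hL : IsAugSeparated L)
    (hα : ∀ q, IsIA (α q)) {l : L} (hl : l ≠ 1) :
    ∃ n, SemidirectProduct.inl l ∉ (⊤ : Subgroup (L ⋊[α] Q)).lowerCentralSeries n := by
  obtain ⟨n, hn⟩ := hL l hl
  refine exists_notMem_lowerCentralSeries_of_filtration (semidirectAction α)
    (fun n => (augIdeal L ^ n).toAddSubgroup) (fun _ _ h => Ideal.pow_le_pow_right h) ?_
    (x := 1) (n := n) ?_ ?_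
  · intro p k x hx
    have h1 := (hα p.right).map_sub_mem k hx
    have hx' : groupAlgebraMap (α p.right) x ∈ augIdeal L ^ k := by
      simpa using add_mem (augIdeal_pow_antitone (Nat.le_succ k) h1) hx
    have h2 := Ideal.mul_mem_mul (of_sub_one_mem_augIdeal p.left) hx'
    rw [← Ideal.IsTwoSided.pow_succ] at h2
    have := add_mem h2 h1
    change semidirectAction α p x - x ∈ augIdeal L ^ (k + 1)
    rw [semidirectAction_apply]
    simpa [sub_mul] using this
  · change (1 : MonoidAlgebra ℚ L) ∈ augIdeal L ^ 0
    rw [Submodule.pow_zero, Ideal.one_eq_top]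
    trivial
  · change semidirectAction α _ 1 - 1 ∉ augIdeal L ^ n
    rw [semidirectAction_apply]
    simpa using hn

theorem IsResiduallyNilpotent.semidirect {L Q : Type u} [Group L] [Group Q] {α : Q →* MulAut L}
    (hL : IsAugSeparated L) (hQ : IsResiduallyNilpotent Q) (hα : ∀ q, IsIA (α q)) :
    IsResiduallyNilpotent (L ⋊[α] Q) := by
  rw [isResiduallyNilpotent_iff] at hQ ⊢
  intro p hp
  by_cases hq : p.right = 1
  · have e : p = SemidirectProduct.inl p.left := by
      ext
      · simp
      · simpa using hq
    rw [e] at hp ⊢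
    exact hL.exists_notMem_lowerCentralSeries hα fun h => hp (by rw [h, map_one])
  · exact exists_notMem_lowerCentralSeries_of_map SemidirectProduct.rightHom (hQ _ hq)

theorem IsResiduallyNilpotent.of_mulEquiv {G H : Type u} [Group G] [Group H] (e : G ≃* H)
    (hH : IsResiduallyNilpotent H) : IsResiduallyNilpotent G := by
  rw [isResiduallyNilpotent_iff] at hH ⊢
  exact fun g hg => exists_notMem_lowerCentralSeries_of_map e.toMonoidHom
    (hH _ (by simpa using hg))

end Semidirect

/-! ### Bi-invariant orders and their consequences. -/

section PositiveCone

/-- `P` is the set of elements larger than `1` for a bi-invariant linear order of `G`. -/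
structure IsPositiveCone {G : Type*} [Group G] (P : Set G) : Prop where
  one_notMem : (1 : G) ∉ P
  mul_mem : ∀ {a b}, a ∈ P → b ∈ P → a * b ∈ P
  mem_or_inv_mem : ∀ {a}, a ≠ 1 → a ∈ P ∨ a⁻¹ ∈ P
  conj_mem : ∀ {a} (b : G), a ∈ P → b * a * b⁻¹ ∈ P

variable {G : Type*} [Group G] {P : Set G}

open Classical in
/-- The linear order with a given positive cone. -/
@[reducible]
noncomputable def IsPositiveCone.linearOrder (hP : IsPositiveCone P) : LinearOrder G where
  le a b := a = b ∨ a⁻¹ * b ∈ P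
  le_refl a := Or.inl rfl
  le_trans a b c := by
    rintro (rfl | hab) (rfl | hbc)
    · exact Or.inl rfl
    · exact Or.inr hbc
    · exact Or.inr hab
    · exact Or.inr (by simpa [mul_assoc] using hP.mul_mem hab hbc)
  le_antisymm a b := by
    rintro (rfl | hab) (h | hba)
    · rfl
    · rfl
    · exact h.symm
    · exact absurd (by simpa [mul_assoc] using hP.mul_mem hab hba) hP.one_notMem
  le_total a b := by
    by_cases h : a = b
    · exact Or.inl (Or.inl h)
    · rcases hP.mem_or_inv_mem (a := a⁻¹ * b) fun h' => h (inv_mul_eq_one.1 h') with h1 | h1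
      · exact Or.inl (Or.inr h1)
      · exact Or.inr (Or.inr (by simpa using h1))
  toDecidableLE := Classical.decRel _

theorem IsPositiveCone.mulLeftMono (hP : IsPositiveCone P) :
    letI := hP.linearOrder; MulLeftMono G :=
  letI := hP.linearOrder
  ⟨fun c a b h => h.imp (fun h => by rw [h]) fun h => by
    simpa [mul_assoc] using h⟩

theorem IsPositiveCone.mulRightMono (hP : IsPositiveCone P) :
    letI := hP.linearOrder; MulRightMono G :=
  letI := hP.linearOrder
  ⟨fun c a b h => h.imp (fun h => by rw [h]) fun h => by
    change (a * c)⁻¹ * (b * c) ∈ P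
    simpa [mul_assoc] using hP.conj_mem c⁻¹ h⟩

theorem IsPositiveCone.prod_conj_mem (hP : IsPositiveCone P) {g : G} (hg : g ∈ P) {l : List G}
    (hl : l ≠ []) : (l.map fun h => h * g * h⁻¹).prod ∈ P := by
  induction l with
  | nil => exact absurd rfl hl
  | cons a l ih =>
    rw [List.map_cons, List.prod_cons]
    rcases eq_or_ne l [] with rfl | h
    · simpa using hP.conj_mem a hg
    · exact hP.mul_mem (hP.conj_mem a hg) (ih h)

theorem IsPositiveCone.inv_prod_conj_mem (hP : IsPositiveCone P) {g : G} (hg : g⁻¹ ∈ P)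
    {l : List G} (hl : l ≠ []) : (l.map fun h => h * g * h⁻¹).prod⁻¹ ∈ P := by
  induction l with
  | nil => exact absurd rfl hl
  | cons a l ih =>
    have ha : (a * g * a⁻¹)⁻¹ ∈ P := by simpa [mul_assoc] using hP.conj_mem a hg
    rw [List.map_cons, List.prod_cons, mul_inv_rev]
    rcases eq_or_ne l [] with rfl | h
    · simpa using ha
    · exact hP.mul_mem (ih h) ha

theorem not_hasGeneralizedTorsion_of_isPositiveCone {G : Type u} [Group G] {P : Set G}
    (hP : IsPositiveCone P) : ¬ HasGeneralizedTorsion G := by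
  rintro ⟨g, hg, l, hl, h⟩
  rcases hP.mem_or_inv_mem hg with hg | hg
  · exact hP.one_notMem (h ▸ hP.prod_conj_mem hg hl)
  · exact hP.one_notMem (by simpa [h] using hP.inv_prod_conj_mem hg hl)

theorem not_isOfFinOrder_of_not_hasGeneralizedTorsion {G : Type u} [Group G]
    (hG : ¬ HasGeneralizedTorsion G) {g : G} (hg : g ≠ 1) : ¬ IsOfFinOrder g := by
  intro h
  obtain ⟨n, hn, hgn⟩ := isOfFinOrder_iff_pow_eq_one.1 h
  refine hG ⟨g, hg, List.replicate n 1, ?_, by simpa using hgn⟩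
  intro h
  simp at h
  omega

theorem IsPositiveCone.exists_embedding {G : Type u} [Group G] {P : Set G}
    (hP : IsPositiveCone P) :
    ∃ (D : Type u) (_ : DivisionRing D) (_ : Algebra ℚ D) (f : MonoidAlgebra ℤ G →+* D),
      Function.Injective f :=
  let := hP.linearOrder
  haveI := hP.mulLeftMono
  haveI := hP.mulRightMono
  ⟨MalcevNeumann ℚ G, inferInstance, inferInstance,
    (MonoidAlgebra.lift ℤ (MalcevNeumann ℚ G) G MalcevNeumann.of).toRingHom,
    MalcevNeumann.lift_of_injective⟩

theorem IsPositiveCone.preimage {H : Type*} [Group H] {P : Set H} (hP : IsPositiveCone P)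
    (e : G ≃* H) : IsPositiveCone (e ⁻¹' P) where
  one_notMem := by simpa using hP.one_notMem
  mul_mem ha hb := by simpa using hP.mul_mem ha hb
  mem_or_inv_mem {a} ha := by simpa using hP.mem_or_inv_mem (a := e a) (by simpa using ha)
  conj_mem b ha := by simpa using hP.conj_mem (e b) ha

/-- The order is lexicographic with `Q` dominant; invariance of `PL` under α is what conjugation by
`Q` requires. -/
theorem IsPositiveCone.semidirect {L Q : Type*} [Group L] [Group Q] {α : Q →* MulAut L}
    {PL : Set L} {PQ : Set Q} (hL : IsPositiveCone PL) (hQ : IsPositiveCone PQ)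
    (hα : ∀ q, ∀ l ∈ PL, α q l ∈ PL) :
    IsPositiveCone {p : L ⋊[α] Q | p.right ∈ PQ ∨ p.right = 1 ∧ p.left ∈ PL} where
  one_notMem := by
    rintro (h | ⟨-, h⟩)
    · exact hQ.one_notMem h
    · exact hL.one_notMem h
  mul_mem := by
    rintro a b (ha | ⟨ha, ha'⟩) (hb | ⟨hb, hb'⟩)
    · exact Or.inl (hQ.mul_mem ha hb)
    · exact Or.inl (by simpa [hb] using ha)
    · exact Or.inl (by simpa [ha] using hb)
    · exact Or.inr ⟨by simp [ha, hb], by simpa [ha] using hL.mul_mem ha' hb'⟩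
  mem_or_inv_mem := by
    intro a ha
    by_cases h : a.right = 1
    · have h' : a.left ≠ 1 := fun h' => ha (by ext <;> simp [h, h'])
      rcases hL.mem_or_inv_mem h' with h1 | h1
      · exact Or.inl (Or.inr ⟨h, h1⟩)
      · exact Or.inr (Or.inr ⟨by simp [h], by simpa [h] using h1⟩)
    · exact (hQ.mem_or_inv_mem h).imp Or.inl Or.inl
  conj_mem := by
    rintro a b (ha | ⟨ha, ha'⟩)
    · exact Or.inl (by simpa using hQ.conj_mem b.right ha)
    · refine Or.inr ⟨by simp [ha], ?_⟩
      have := hL.conj_mem b.left (hα b.right _ ha')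
      have e : (b * a * b⁻¹).left = b.left * α b.right a.left * b.left⁻¹ := by
        simp only [SemidirectProduct.mul_left, SemidirectProduct.mul_right,
          SemidirectProduct.inv_left, ha, mul_one, map_inv, MulAut.apply_inv_self]
      rwa [e]

end PositiveCone

/-! ### Ordering a group by its augmentation filtration. -/

section LinearCone

variable {V : Type*} [AddCommGroup V] [Module ℚ V]

/-- Order V/W lexicographically by coordinates in a well-ordered basis and pull the positive
elements back. -/
theorem Submodule.exists_positiveCone (W : Submodule ℚ V) :
    ∃ C : Set V, 0 ∉ C ∧ (∀ x ∈ C, ∀ y ∈ C, x + y ∈ C) ∧ (∀ x ∈ C, ∀ w ∈ W, x + w ∈ C) ∧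
      ∀ x ∉ W, x ∈ C ∨ -x ∈ C := by
  classical
  let b := Module.Basis.ofVectorSpace ℚ (V ⧸ W)
  letI : LinearOrder (Module.Basis.ofVectorSpaceIndex ℚ (V ⧸ W)) :=
    linearOrderOfSTO WellOrderingRel
  let f : V →+ Lex (Module.Basis.ofVectorSpaceIndex ℚ (V ⧸ W) →₀ ℚ) :=
    { toFun := fun x => toLex (b.repr (W.mkQ x))
      map_zero' := by simp
      map_add' := fun x y => by simp }
  have hf : ∀ x, f x = 0 ↔ x ∈ W := fun x => by
    change toLex (b.repr (W.mkQ x)) = 0 ↔ _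
    simp
  refine ⟨{x | 0 < f x}, ?_, fun x hx y hy => ?_, fun x hx w hw => ?_, fun x hx => ?_⟩
  · simp
  · rw [Set.mem_ofPred] at *
    rw [map_add]
    exact add_pos hx hy
  · rw [Set.mem_ofPred] at *
    rwa [map_add, (hf w).2 hw, add_zero]
  · rw [Set.mem_ofPred, Set.mem_ofPred, map_neg, Left.neg_pos_iff]
    exact (lt_or_gt_of_ne fun h => hx ((hf x).1 h)).symm

variable {L : Type*} [Group L]

open MonoidAlgebra

/-- The cone records the sign of g - 1 in I^n/I^(n+1) at its depth n. Automorphisms trivial on the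
abelianization do not change this class, and conjugations are among them. -/
theorem IsAugSeparated.exists_isPositiveCone (hL : IsAugSeparated L) :
    ∃ P : Set L, IsPositiveCone P ∧ ∀ φ, IsIA φ → ∀ g ∈ P, φ g ∈ P := by
  choose C h0 hadd hmod hpm using fun n =>
    Submodule.exists_positiveCone ((augIdeal L ^ (n + 1)).restrictScalars ℚ)
  have hC : ∀ {n x}, x ∈ C n → x ∉ augIdeal L ^ (n + 1) := fun {n x} hx hx' =>
    h0 n (by simpa using hmod n x hx (-x) (neg_mem hx'))
  -- Depth 0 never occurs, so the cross term (a - 1)(b - 1) of ab - 1 is strictly deeper than the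
  -- shallower of the two factors.
  have hpos : ∀ {n} {g : L}, of ℚ L g - 1 ∈ C n → 1 ≤ n := fun {n g} hg => by
    by_contra h
    obtain rfl : n = 0 := by omega
    refine hC hg ?_
    rw [zero_add, Submodule.pow_one]
    exact of_sub_one_mem_augIdeal g
  have hia : ∀ φ, IsIA φ → ∀ g ∈ {g | ∃ n, of ℚ L g - 1 ∈ augIdeal L ^ n ∧ of ℚ L g - 1 ∈ C n},
      φ g ∈ {g | ∃ n, of ℚ L g - 1 ∈ augIdeal L ^ n ∧ of ℚ L g - 1 ∈ C n} := by
    rintro φ hφ g ⟨n, hn, hgC⟩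
    have h1 := hφ.map_sub_mem n hn
    rw [map_sub, map_one, groupAlgebraMap_of] at h1
    refine ⟨n, ?_, ?_⟩
    · simpa using add_mem hn (augIdeal_pow_antitone (Nat.le_succ n) h1)
    · simpa using hmod n _ hgC _ h1
  refine ⟨_, ⟨?_, ?_, ?_, fun b hg => hia _ (isIA_conj b) _ hg⟩, hia⟩
  · rintro ⟨n, -, h⟩
    rw [map_one, sub_self] at h
    exact h0 n h
  · rintro a b ⟨n, ha, haC⟩ ⟨m, hb, hbC⟩
    have hn := hpos haC
    have hm := hpos hbC
    have hab := mul_mem_augIdeal_pow ha hb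
    have e : of ℚ L (a * b) - 1 = (of ℚ L a - 1) + (of ℚ L b - 1) +
        (of ℚ L a - 1) * (of ℚ L b - 1) := by
      rw [map_mul]; noncomm_ring
    rcases lt_trichotomy n m with h | rfl | h
    · refine ⟨n, ?_, ?_⟩ <;> rw [e]
      · exact add_mem (add_mem ha (augIdeal_pow_antitone h.le hb))
          (augIdeal_pow_antitone (by omega) hab)
      · exact hmod n _ (hmod n _ haC _ (augIdeal_pow_antitone h hb)) _
          (augIdeal_pow_antitone (by omega) hab)
    · refine ⟨n, ?_, ?_⟩ <;> rw [e]
      · exact add_mem (add_mem ha hb) (augIdeal_pow_antitone (by omega) hab)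
      · exact hmod n _ (hadd n _ haC _ hbC) _ (augIdeal_pow_antitone (by omega) hab)
    · refine ⟨m, ?_, ?_⟩ <;> rw [e, add_comm (of ℚ L a - 1)]
      · exact add_mem (add_mem hb (augIdeal_pow_antitone h.le ha))
          (augIdeal_pow_antitone (by omega) hab)
      · exact hmod m _ (hmod m _ hbC _ (augIdeal_pow_antitone h ha)) _
          (augIdeal_pow_antitone (by omega) hab)
  · intro g hg
    obtain ⟨n, hn, hn'⟩ : ∃ n, of ℚ L g - 1 ∈ augIdeal L ^ n ∧
        of ℚ L g - 1 ∉ augIdeal L ^ (n + 1) := by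
      by_contra! H
      obtain ⟨n, hn⟩ := hL g hg
      refine hn ?_
      clear hn
      induction n with
      | zero => rw [Submodule.pow_zero, Ideal.one_eq_top]; trivial
      | succ n ih => exact H n ih
    rcases hpm n _ hn' with h | h
    · exact Or.inl ⟨n, hn, h⟩
    · right
      -- Modulo I^(n+1), g⁻¹ - 1 is the negative of g - 1.
      have h1 : (of ℚ L g⁻¹ - 1) * (of ℚ L g - 1) ∈ augIdeal L ^ (n + 1) := by
        rw [Ideal.IsTwoSided.pow_succ]
        exact Ideal.mul_mem_mul (of_sub_one_mem_augIdeal _) hn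
      have e : of ℚ L g⁻¹ - 1 =
          -(of ℚ L g - 1) + -((of ℚ L g⁻¹ - 1) * (of ℚ L g - 1)) := by
        have : of ℚ L g⁻¹ * of ℚ L g = 1 := by rw [← map_mul, inv_mul_cancel, map_one]
        rw [mul_sub, sub_mul, this]
        noncomm_ring
      refine ⟨n, ?_, ?_⟩ <;> rw [e]
      · exact add_mem (neg_mem hn) (neg_mem (augIdeal_pow_antitone (Nat.le_succ n) h1))
      · exact hmod n _ h _ (neg_mem h1)

end LinearCone

/-! ### Induction over the semidirect factors. -/

/-- The properties that pass from an `L` separated by its augmentation powers to iterated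
semidirect products. -/
theorem IsAlmostDirectProductOf.isResiduallyNilpotent_and_exists_isPositiveCone
    {P : ∀ (L : Type u) [Group L], Prop}
    (hP : ∀ (L : Type u) [Group L], P L → IsAugSeparated L) {G : Type u} [Group G]
    (hG : IsAlmostDirectProductOf P G) :
    IsResiduallyNilpotent G ∧ ∃ C : Set G, IsPositiveCone C := by
  induction hG with
  | factor G h =>
    obtain ⟨C, hC, -⟩ := (hP G h).exists_isPositiveCone
    refine ⟨?_, C, hC⟩
    rw [isResiduallyNilpotent_iff]
    intro g hg
    -- A single factor is embedded in a product with trivial action, so that the semidirect argument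
    -- applies.
    exact exists_notMem_lowerCentralSeries_of_map
      (SemidirectProduct.inl : G →* G ⋊[(1 : G →* MulAut G)] G)
      ((hP G h).exists_notMem_lowerCentralSeries (fun _ => MonoidHom.ext fun x => by
        induction x using QuotientGroup.induction_on; rfl) hg)
  | semidirect L Q G α hL hQ hα e ih =>
    obtain ⟨hres, CQ, hCQ⟩ := ih
    obtain ⟨CL, hCL, hinv⟩ := (hP L hL).exists_isPositiveCone
    exact ⟨(IsResiduallyNilpotent.semidirect (hP L hL) hres hα).of_mulEquiv e, _,
      (hCL.semidirect hCQ fun q l hl => hinv _ (hα q) l hl).preimage e⟩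

/-! ### Magnus-type representations on words. -/

section PrependRepresentation

open Finsupp

variable (R : Type*) [CommRing R] {X : Type*}

open Classical in
/-- The operator sending the basis vector `l` to `x :: l` if that satisfies `P`, and to `0`
otherwise. -/
noncomputable def prepend (P : List X → Prop) (x : X) : Module.End R (List X →₀ R) :=
  Finsupp.linearCombination R fun l => if P (x :: l) then single (x :: l) 1 else 0

variable {R} {P : List X → Prop}

open Classical in
theorem prepend_single (x : X) (l : List X) (c : R) :
    prepend R P x (single l c) = if P (x :: l) then single (x :: l) c else 0 := by
  rw [prepend, linearCombination_single]
  split_ifs <;> simp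

theorem prepend_apply_nil (x : X) (v : List X →₀ R) : prepend R P x v [] = 0 := by
  classical
  induction v using Finsupp.induction_linear with
  | zero => simp
  | add v w hv hw => rw [map_add, Finsupp.add_apply, hv, hw, add_zero]
  | single l c => rw [prepend_single]; split_ifs <;> simp

open Classical in
theorem prepend_apply_cons (x y : X) (l : List X) (v : List X →₀ R) :
    prepend R P x v (y :: l) = if y = x ∧ P (y :: l) then v l else 0 := by
  induction v using Finsupp.induction_linear with
  | zero => simp
  | add v w hv hw => rw [map_add, Finsupp.add_apply, hv, hw, Finsupp.add_apply]; split_ifs <;> simp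
  | single m c =>
    rw [prepend_single]
    by_cases hyx : y = x
    · subst hyx
      by_cases hml : m = l
      · subst hml; by_cases hP : P (y :: m) <;> simp [hP]
      · have h1 : y :: m ≠ y :: l := by simpa using hml
        rw [single_eq_of_ne (Ne.symm hml), ite_self]
        split_ifs
        · exact single_eq_of_ne h1.symm
        · rfl
    · rw [if_neg (c := y = x ∧ P (y :: l)) fun h => hyx h.1]
      split_ifs
      · exact single_eq_of_ne fun h => hyx (List.cons.inj h).1
      · rfl

theorem prepend_mul_self (hP : ∀ x l, ¬ P (x :: x :: l)) (x : X) :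
    prepend R P x * prepend R P x = 0 := by
  classical
  refine Finsupp.lhom_ext fun l c => ?_
  rw [Module.End.mul_apply, prepend_single, LinearMap.zero_apply]
  split_ifs
  · rw [prepend_single, if_neg (hP x l)]
  · simp

theorem prepend_add_neg_one_smul (x : X) :
    prepend R P x + (-1 : R) • prepend R P x = 0 :=
  LinearMap.ext fun v => by
    change prepend R P x v + (-1 : R) • prepend R P x v = 0
    rw [neg_one_smul, add_neg_cancel]

variable (R) in
/-- The unipotent operator `1 + prepend x`. -/
noncomputable def onePlusPrepend (hP : ∀ x l, ¬ P (x :: x :: l)) (x : X) :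
    (Module.End R (List X →₀ R))ˣ where
  val := 1 + prepend R P x
  inv := 1 + (-1 : R) • prepend R P x
  val_inv := by
    have := prepend_mul_self (R := R) hP x
    rw [mul_add, mul_one, mul_smul_comm, add_mul, one_mul, this, add_zero, add_assoc,
      prepend_add_neg_one_smul, add_zero]
  inv_val := by
    have := prepend_mul_self (R := R) hP x
    rw [mul_add, mul_one, add_mul, one_mul, smul_mul_assoc, this, smul_zero, add_zero,
      add_assoc, add_comm ((-1 : R) • _), prepend_add_neg_one_smul, add_zero]

variable (R) in
/-- The Magnus-type representation of the free group. -/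
noncomputable def magnusRep (hP : ∀ x l, ¬ P (x :: x :: l)) :
    FreeGroup X →* (Module.End R (List X →₀ R))ˣ :=
  FreeGroup.lift (onePlusPrepend R hP)

theorem magnusRep_of_apply (hP : ∀ x l, ¬ P (x :: x :: l)) (x : X) (v : List X →₀ R) :
    (magnusRep R hP (FreeGroup.of x) : Module.End R _) v = v + prepend R P x v := by
  rw [magnusRep, FreeGroup.lift_apply_of]
  rfl

theorem magnusRep_of_inv_apply (hP : ∀ x l, ¬ P (x :: x :: l)) (x : X) (v : List X →₀ R) :
    (magnusRep R hP (FreeGroup.of x)⁻¹ : Module.End R _) v = v - prepend R P x v := by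
  rw [map_inv, magnusRep, FreeGroup.lift_apply_of]
  change v + (-1 : R) • prepend R P x v = _
  rw [neg_one_smul, sub_eq_add_neg]

theorem magnusRep_mul_apply (hP : ∀ x l, ¬ P (x :: x :: l)) (a b : FreeGroup X)
    (v : List X →₀ R) : (magnusRep R hP (a * b) : Module.End R _) v =
      (magnusRep R hP a : Module.End R _) ((magnusRep R hP b : Module.End R _) v) := by
  rw [map_mul]; rfl

variable (R X) in
/-- The vectors supported on lists of length at least `n`. -/
def lengthFiltration (n : ℕ) : Submodule R (List X →₀ R) where
  carrier := {v | ∀ l, l.length < n → v l = 0}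
  zero_mem' _ _ := rfl
  add_mem' hv hw l hl := by rw [Finsupp.add_apply, hv l hl, hw l hl, add_zero]
  smul_mem' c v hv l hl := by rw [Finsupp.smul_apply, hv l hl, smul_zero]

theorem mem_lengthFiltration {n : ℕ} {v : List X →₀ R} :
    v ∈ lengthFiltration R X n ↔ ∀ l, l.length < n → v l = 0 := Iff.rfl

theorem lengthFiltration_antitone : Antitone (lengthFiltration R X) :=
  fun _ _ h _ hv l hl => hv l (hl.trans_le h)

theorem prepend_mem_lengthFiltration (x : X) {n : ℕ} {v : List X →₀ R}
    (hv : v ∈ lengthFiltration R X n) : prepend R P x v ∈ lengthFiltration R X (n + 1) := by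
  classical
  rintro (_ | ⟨y, l⟩) hl
  · exact prepend_apply_nil x v
  · rw [prepend_apply_cons, hv l (by simpa using hl), ite_self]

theorem magnusRep_sub_mem (hP : ∀ x l, ¬ P (x :: x :: l)) (g : FreeGroup X) (n : ℕ)
    {v : List X →₀ R} (hv : v ∈ lengthFiltration R X n) :
    (magnusRep R hP g : Module.End R _) v - v ∈ lengthFiltration R X (n + 1) := by
  induction g using FreeGroup.induction_on generalizing v with
  | C1 => simp
  | of x =>
    rw [magnusRep_of_apply, add_sub_cancel_left]
    exact prepend_mem_lengthFiltration x hv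
  | inv_of x _ =>
    rw [magnusRep_of_inv_apply, sub_sub_cancel_left]
    exact neg_mem (prepend_mem_lengthFiltration x hv)
  | mul a b ha hb =>
    rw [magnusRep_mul_apply]
    have h1 := hb hv
    have h2 := add_mem (lengthFiltration_antitone (Nat.le_succ n) h1) hv
    rw [sub_add_cancel] at h2
    simpa using add_mem (ha h2) h1

theorem magnusRep_apply_single_nil (hP : ∀ x l, ¬ P (x :: x :: l)) (g : FreeGroup X) :
    (magnusRep R hP g : Module.End R (List X →₀ R)) (single [] (1 : R)) [] = 1 := by
  have := magnusRep_sub_mem hP g 0 (v := single [] (1 : R)) (by simp [mem_lengthFiltration]) []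
    (by simp)
  rw [Finsupp.sub_apply, sub_eq_zero] at this
  rw [this, single_eq_same]

/-- If g - 1 lies in every I^n, then g moves the empty word by a vector with no words of length
below any n, that is, by 0. -/
theorem isAugSeparated_of_magnusRep {L : Type*} [Group L] (hP : ∀ x l, ¬ P (x :: x :: l))
    (π : FreeGroup X →* L) (hπ : Function.Surjective π)
    (ρ : L →* (Module.End ℚ (List X →₀ ℚ))ˣ) (hρ : ρ.comp π = magnusRep ℚ hP)
    (hker : ∀ g, (magnusRep ℚ hP g : Module.End ℚ (List X →₀ ℚ)) (single [] (1 : ℚ)) = single [] (1 : ℚ) → π g = 1) :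
    IsAugSeparated L := by
  intro g hg
  by_contra! H
  obtain ⟨w, rfl⟩ := hπ g
  refine hg (hker w ?_)
  have hρw : ∀ w, ρ (π w) = magnusRep ℚ hP w := fun w => DFunLike.congr_fun hρ w
  have h : ∀ n, (magnusRep ℚ hP w : Module.End ℚ _) (single [] (1 : ℚ)) - single [] (1 : ℚ) ∈
      lengthFiltration ℚ X (0 + n) := fun n => by
    have := lift_mem_of_mem_augIdeal_pow ((Units.coeHom _).comp ρ) (lengthFiltration ℚ X)
      lengthFiltration_antitone (fun g k v hv => by
        obtain ⟨w, rfl⟩ := hπ g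
        have := magnusRep_sub_mem hP w k hv
        rwa [← hρw] at this) n (H n) 0 (v := single [] (1 : ℚ)) (by simp [mem_lengthFiltration])
    rw [map_sub, MonoidAlgebra.lift_of, map_one] at this
    rw [← hρw]
    exact this
  rw [← sub_eq_zero]
  ext l
  exact h (l.length + 1) l (by simp)

end PrependRepresentation

/-! ### Separation for free groups. -/

section FreeGroup

open Finsupp Monoid

variable {X : Type*}

theorem not_isChain_ne_cons_cons (x : X) (l : List X) :
    ¬ (x :: x :: l).IsChain (· ≠ ·) := by simp

theorem FreeGroup.exists_zpow_of_unit (m : FreeGroup Unit) :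
    ∃ n : ℤ, m = FreeGroup.of () ^ n := by
  induction m using FreeGroup.induction_on with
  | C1 => exact ⟨0, by simp⟩
  | of x => exact ⟨1, by simp⟩
  | inv_of x _ => exact ⟨-1, by simp⟩
  | mul a b ha hb =>
    obtain ⟨m, rfl⟩ := ha
    obtain ⟨n, rfl⟩ := hb
    exact ⟨m + n, by rw [zpow_add]⟩

theorem onePlusPrepend_zpow {R : Type*} [CommRing R] {P : List X → Prop}
    (hP : ∀ x l, ¬ P (x :: x :: l)) (x : X) (n : ℤ) :
    ((onePlusPrepend R hP x ^ n : (Module.End R (List X →₀ R))ˣ) : Module.End R _) =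
      1 + (n : R) • prepend R P x := by
  have h0 := prepend_mul_self (R := R) hP x
  induction n using Int.induction_on with
  | zero => simp
  | succ n ih =>
    rw [zpow_add_one, Units.val_mul, ih]
    change _ * (1 + prepend R P x) = _
    rw [add_mul, one_mul, smul_mul_assoc, mul_add, mul_one, h0, add_zero, Int.cast_add,
      Int.cast_one, add_smul, one_smul, add_assoc, add_comm (prepend R P x)]
  | pred n ih =>
    rw [zpow_sub_one, Units.val_mul, ih]
    change _ * (1 + (-1 : R) • prepend R P x) = _
    rw [add_mul, one_mul, smul_mul_assoc, mul_add, mul_one, mul_smul_comm, h0, smul_zero, add_zero,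
      sub_eq_add_neg, Int.cast_add, add_smul, add_assoc, add_comm ((-1 : R) • _), Int.cast_neg,
      Int.cast_neg, Int.cast_one]

variable (X) in
/-- The Magnus-type representation, on the free product of infinite cyclic groups. -/
noncomputable def coprodMagnusRep :
    CoprodI (fun _ : X => FreeGroup Unit) →* (Module.End ℚ (List X →₀ ℚ))ˣ :=
  (magnusRep ℚ not_isChain_ne_cons_cons).comp freeGroupEquivCoprodI.symm.toMonoidHom

theorem coprodMagnusRep_of (x : X) (n : ℤ) :
    (coprodMagnusRep X (CoprodI.of (i := x) (FreeGroup.of () ^ n)) : Module.End ℚ _) =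
      1 + (n : ℚ) • prepend ℚ (List.IsChain (· ≠ ·)) x := by
  rw [← onePlusPrepend_zpow not_isChain_ne_cons_cons, map_zpow, map_zpow]
  congr 2

/-- A syllable x^n acts as 1 + n · `prepend` x, so each new syllable multiplies the top coefficient
by its exponent; the coefficient at the word of syllable letters is the product of all exponents. -/
theorem coprodMagnusRep_prod_apply (s : List (Σ _ : X, FreeGroup Unit))
    (hs : ∀ a ∈ s, a.2 ≠ 1) (hc : (s.map Sigma.fst).IsChain (· ≠ ·)) :
    (coprodMagnusRep X (s.map fun a => CoprodI.of (i := a.1) a.2).prod :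
      Module.End ℚ (List X →₀ ℚ)) (single [] (1 : ℚ))
        (s.map Sigma.fst) ≠ 0 ∧
      ∀ l : List X, s.length < l.length →
        (coprodMagnusRep X (s.map fun a => CoprodI.of (i := a.1) a.2).prod :
      Module.End ℚ (List X →₀ ℚ)) (single [] (1 : ℚ)) l
          = 0 := by
  classical
  induction s with
  | nil =>
    refine ⟨by simp, fun l hl => ?_⟩
    have : l ≠ [] := by rintro rfl; simp at hl
    simp [single_eq_of_ne this]
  | cons a s ih =>
    obtain ⟨x, m⟩ := a
    obtain ⟨n, rfl⟩ := FreeGroup.exists_zpow_of_unit m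
    have hn : n ≠ 0 := by
      rintro rfl
      exact hs _ List.mem_cons_self (by simp)
    obtain ⟨h1, h2⟩ := ih (fun a ha => hs a (List.mem_cons_of_mem _ ha))
      (List.IsChain.tail hc)
    set v := (coprodMagnusRep X (s.map fun a => CoprodI.of (i := a.1) a.2).prod :
      Module.End ℚ (List X →₀ ℚ))
      (single [] (1 : ℚ)) with hv
    have e : (coprodMagnusRep X (((⟨x, FreeGroup.of () ^ n⟩ : Σ _ : X, FreeGroup Unit) :: s).map
        fun a => CoprodI.of (i := a.1) a.2).prod :
      Module.End ℚ (List X →₀ ℚ)) (single [] (1 : ℚ)) =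
        v + (n : ℚ) • prepend ℚ (List.IsChain (· ≠ ·)) x v := by
      rw [List.map_cons, List.prod_cons, map_mul, Units.val_mul, Module.End.mul_apply, ← hv,
        coprodMagnusRep_of]
      simp
    rw [e]
    refine ⟨?_, ?_⟩
    · rw [List.map_cons, Finsupp.add_apply, Finsupp.smul_apply, h2 _ (by simp), prepend_apply_cons,
        if_pos ⟨rfl, hc⟩, zero_add, smul_eq_mul]
      exact mul_ne_zero (by exact_mod_cast hn) h1
    · rintro (_ | ⟨y, l⟩) hl
      · simp at hl
      · simp only [List.length_cons] at hl
        rw [Finsupp.add_apply, Finsupp.smul_apply, h2 _ (by simp; omega), prepend_apply_cons,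
          h2 l (by omega), ite_self, smul_zero, add_zero]

theorem FreeGroup.isAugSeparated (X : Type*) : IsAugSeparated (FreeGroup X) := by
  classical
  refine isAugSeparated_of_magnusRep not_isChain_ne_cons_cons (MonoidHom.id _)
    Function.surjective_id _ (MonoidHom.comp_id _) fun g hg => ?_
  obtain ⟨w, hw⟩ := CoprodI.Word.equiv.symm.surjective (freeGroupEquivCoprodI g)
  have hw' : freeGroupEquivCoprodI g = (w.toList.map fun a => CoprodI.of (i := a.1) a.2).prod := hw.symm
  obtain ⟨h1, -⟩ := coprodMagnusRep_prod_apply w.toList (fun a ha => w.ne_one a ha)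
    ((List.isChain_map _).2 w.chain_ne)
  rw [← hw'] at h1
  have e : coprodMagnusRep X (freeGroupEquivCoprodI g) =
      magnusRep ℚ not_isChain_ne_cons_cons g :=
    congrArg (magnusRep ℚ _) (freeGroupEquivCoprodI.symm_apply_apply g)
  rw [e, hg] at h1
  -- A nonempty word has coefficient 0 in the fixed empty word, against `h1`.
  have h3 : w.toList = [] := by
    by_contra h
    exact h1 (single_eq_of_ne (by simpa using h))
  rw [h3] at hw'
  exact freeGroupEquivCoprodI.map_eq_one_iff.1 hw'

end FreeGroup

theorem IsAugSeparated.of_mulEquiv {L M : Type*} [Group L] [Group M] (e : L ≃* M)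
    (hM : IsAugSeparated M) : IsAugSeparated L := by
  intro g hg
  obtain ⟨n, hn⟩ := hM (e g) (by simpa using hg)
  refine ⟨n, fun h => hn ?_⟩
  have key : ∀ (n : ℕ) (x : MonoidAlgebra ℚ L), x ∈ augIdeal L ^ n →
      MonoidAlgebra.mapDomainRingHom ℚ e.toMonoidHom x ∈ augIdeal M ^ n := by
    intro n
    induction n with
    | zero => intro x _; rw [Submodule.pow_zero, Ideal.one_eq_top]; trivial
    | succ n ih =>
      intro x hx
      rw [Submodule.pow_succ] at hx ⊢
      refine Submodule.mul_induction_on hx (fun a ha b hb => ?_) fun a b ha hb => ?_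
      · rw [map_mul]
        refine Ideal.mul_mem_mul (ih a ha) ?_
        have e1 : ((MonoidAlgebra.lift ℚ ℚ M 1).toRingHom.comp
            (MonoidAlgebra.mapDomainRingHom ℚ e.toMonoidHom)) =
            (MonoidAlgebra.lift ℚ ℚ L 1).toRingHom := by ext <;> simp
        exact (DFunLike.congr_fun e1 b).trans hb
      · rw [map_add]; exact add_mem ha hb
  have := key n _ h
  rw [map_sub, map_one] at this
  simpa using this

theorem IsFreeGroup.isAugSeparated (L : Type*) [Group L] [IsFreeGroup L] : IsAugSeparated L :=
  (FreeGroup.isAugSeparated _).of_mulEquiv (IsFreeGroup.mulEquiv L).symm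

/-! ### The representation on words with distinct letters. -/

section ReducedMagnusRep

open Finsupp

variable {X : Type u}

theorem not_nodup_cons_cons (x : X) (l : List X) : ¬ (x :: x :: l).Nodup := by simp

variable (R : Type*) [CommRing R]

/-- The Magnus-type representation with squarefree monomials. -/
noncomputable abbrev nodupRep : FreeGroup X →* (Module.End R (List X →₀ R))ˣ :=
  magnusRep R not_nodup_cons_cons

variable {R}

theorem nodupRep_apply_eq_zero_of_notMem (g : FreeGroup X) (x : X) {v : List X →₀ R}
    (hv : ∀ l, x ∉ l → v l = 0) (l : List X) (hl : x ∉ l) :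
    (nodupRep R g : Module.End R (List X →₀ R)) v l = 0 := by
  classical
  have hpre : ∀ (y : X) {v : List X →₀ R}, (∀ l, x ∉ l → v l = 0) → ∀ l, x ∉ l →
      prepend R List.Nodup y v l = 0 := by
    rintro y v hv (_ | ⟨z, l⟩) hl
    · exact prepend_apply_nil y v
    · rw [prepend_apply_cons, hv l fun h => hl (List.mem_cons_of_mem _ h), ite_self]
  induction g using FreeGroup.induction_on generalizing v l with
  | C1 => simpa using hv l hl
  | of y => rw [magnusRep_of_apply, Finsupp.add_apply, hv l hl, hpre y hv l hl, add_zero]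
  | inv_of y _ => rw [magnusRep_of_inv_apply, Finsupp.sub_apply, hv l hl, hpre y hv l hl, sub_zero]
  | mul a b ha hb =>
    rw [magnusRep_mul_apply]
    exact ha (fun l hl => hb hv l hl) l hl

/-- After the first `prepend` x every word contains x, and the action of g keeps it there, so
prepending x again repeats a letter. -/
theorem prepend_mul_nodupRep_mul_prepend (g : FreeGroup X) (x : X) :
    prepend R List.Nodup x * (nodupRep R g : Module.End R (List X →₀ R)) *
      prepend R List.Nodup x = 0 := by
  classical
  refine LinearMap.ext fun v => Finsupp.ext fun l => ?_
  have h1 : ∀ l, x ∉ l → prepend R List.Nodup x v l = 0 := by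
    rintro (_ | ⟨z, l⟩) hl
    · exact prepend_apply_nil x v
    · rw [prepend_apply_cons, if_neg]
      rintro ⟨rfl, -⟩
      exact hl List.mem_cons_self
  have h2 := nodupRep_apply_eq_zero_of_notMem g x h1
  change prepend R List.Nodup x ((nodupRep R g : Module.End R (List X →₀ R)) _) l = 0
  rcases l with _ | ⟨z, l⟩
  · exact prepend_apply_nil x _
  · rw [prepend_apply_cons]
    split_ifs with h
    · obtain ⟨rfl, h⟩ := h
      exact h2 l (List.nodup_cons.1 h).1
    · rfl

/-- Both products of T and its conjugate ATB vanish, so 1 + T and 1 + ATB commute. -/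
theorem nodupRep_relation (g : FreeGroup X) (x : X) :
    nodupRep R ⁅FreeGroup.of x, g * FreeGroup.of x * g⁻¹⁆ = 1 := by
  rw [map_commutatorElement, commutatorElement_eq_one_iff_mul_comm]
  set T := prepend R (List.Nodup (α := X)) x
  set A := (nodupRep R g : Module.End R (List X →₀ R))
  set B := (nodupRep R g⁻¹ : Module.End R (List X →₀ R))
  have hAB : A * B = 1 := by
    rw [← Units.val_mul, ← map_mul, mul_inv_cancel, map_one, Units.val_one]
  have hA : T * A * T = 0 := prepend_mul_nodupRep_mul_prepend g x
  have hB : T * B * T = 0 := prepend_mul_nodupRep_mul_prepend g⁻¹ x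
  have hx : (nodupRep R (FreeGroup.of x) : Module.End R (List X →₀ R)) = 1 + T :=
    LinearMap.ext fun v => magnusRep_of_apply _ x v
  have hgx : (nodupRep R (g * FreeGroup.of x * g⁻¹) : Module.End R (List X →₀ R)) =
      1 + A * T * B := by
    rw [map_mul, map_mul, Units.val_mul, Units.val_mul, hx, mul_add, mul_one, add_mul, hAB]
  refine Units.ext ?_
  rw [Units.val_mul, Units.val_mul, hx, hgx]
  have h1 : T * (A * T * B) = 0 := by rw [← mul_assoc, ← mul_assoc, hA, zero_mul]
  have h2 : A * T * B * T = 0 := by rw [mul_assoc, mul_assoc, ← mul_assoc T, hB, mul_zero]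
  rw [mul_add, mul_one, add_mul, one_mul, h1, mul_add, mul_one, add_mul, one_mul, h2, add_zero,
    add_zero, add_assoc, add_assoc, add_comm T]

/-- Needed to pass from ℚ to ℤ, since `commMap` only accepts integer coefficients. -/
theorem map_nodupRep_apply {S : Type*} [CommRing S] (f : R →+* S) (g : FreeGroup X)
    (v : List X →₀ R) :
    mapRange f (map_zero f) ((nodupRep R g : Module.End R (List X →₀ R)) v) =
      (nodupRep S g : Module.End S (List X →₀ S)) (mapRange f (map_zero f) v) := by
  classical
  have hpre : ∀ (x : X) (v : List X →₀ R), mapRange f (map_zero f) (prepend R List.Nodup x v) =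
      prepend S List.Nodup x (mapRange f (map_zero f) v) := by
    intro x v
    ext l
    rw [mapRange_apply]
    rcases l with _ | ⟨y, l⟩
    · rw [prepend_apply_nil, prepend_apply_nil, map_zero]
    · rw [prepend_apply_cons, prepend_apply_cons, mapRange_apply]
      split_ifs
      · rfl
      · exact map_zero f
  induction g using FreeGroup.induction_on generalizing v with
  | C1 => simp
  | of x =>
    rw [magnusRep_of_apply, magnusRep_of_apply, mapRange_add (map_add f), hpre]
  | inv_of x _ =>
    rw [magnusRep_of_inv_apply, magnusRep_of_inv_apply, mapRange_sub (map_sub f), hpre]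
  | mul a b ha hb => rw [magnusRep_mul_apply, magnusRep_mul_apply, ha, hb]

end ReducedMagnusRep

/-! ### Separation for reduced free groups. -/

namespace ReducedFreeGroup

variable {X : Type u}

/-- The quotient map from the free group. -/
def mk : FreeGroup X →* ReducedFreeGroup X := PresentedGroup.mk _

/-- The generators of the reduced free group. -/
def of (x : X) : ReducedFreeGroup X := PresentedGroup.of x

theorem mk_of (x : X) : mk (FreeGroup.of x) = of x := rfl

theorem mk_surjective : Function.Surjective (mk (X := X)) := PresentedGroup.mk_surjective _

theorem of_commute_conj (x : X) (g : ReducedFreeGroup X) : Commute (of x) (g * of x * g⁻¹) := by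
  obtain ⟨w, rfl⟩ := mk_surjective g
  refine commutatorElement_eq_one_iff_mul_comm.1 ?_
  have h : mk ⁅FreeGroup.of x, w * FreeGroup.of x * w⁻¹⁆ = 1 :=
    PresentedGroup.one_of_mem ⟨x, w, rfl⟩
  simpa [map_commutatorElement, mk_of] using h

/-- The normal closure of a generator. -/
def genClosure (x : X) : Subgroup (ReducedFreeGroup X) := Subgroup.normalClosure {of x}

instance (x : X) : (genClosure x).Normal := Subgroup.normalClosure_normal

theorem of_mem_genClosure (x : X) : of x ∈ genClosure x :=
  Subgroup.subset_normalClosure rfl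

/-- The defining relations say, after conjugation, that any two conjugates of a generator commute.
-/
theorem isMulCommutative_genClosure (x : X) : IsMulCommutative (genClosure x) := by
  refine Subgroup.isMulCommutative_closure ?_
  intro a ha b hb
  simp only [Group.mem_conjugatesOfSet_iff, Set.mem_singleton_iff, exists_eq_left,
    isConj_iff] at ha hb
  obtain ⟨c, rfl⟩ := ha
  obtain ⟨d, rfl⟩ := hb
  have h := (of_commute_conj x (c⁻¹ * d)).eq
  calc c * of x * c⁻¹ * (d * of x * d⁻¹)
      = c * (of x * (c⁻¹ * d * of x * (c⁻¹ * d)⁻¹)) * c⁻¹ := by group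
    _ = c * (c⁻¹ * d * of x * (c⁻¹ * d)⁻¹ * of x) * c⁻¹ := by rw [h]
    _ = d * of x * d⁻¹ * (c * of x * c⁻¹) := by group

instance (x : X) : CommGroup (genClosure x) where
  mul_comm := (isMulCommutative_genClosure x).is_comm.comm

theorem of_commute_of_mem_genClosure {x : X} {n : ReducedFreeGroup X} (hn : n ∈ genClosure x) :
    of x * n * (of x)⁻¹ = n := by
  have h := mul_comm (⟨of x, of_mem_genClosure x⟩ : genClosure x) ⟨n, hn⟩
  have h' : of x * n = n * of x := congrArg Subtype.val h
  rw [h', mul_inv_cancel_right]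

/-- The endomorphism killing the generators in `S` and fixing the others. -/
noncomputable def kill (S : Set X) : ReducedFreeGroup X →* ReducedFreeGroup X := by
  classical
  exact PresentedGroup.toGroup (f := fun y => if y ∈ S then 1 else of y) (by
    rintro _ ⟨x, g, rfl⟩
    rw [map_commutatorElement, commutatorElement_eq_one_iff_mul_comm, map_mul, map_mul, map_inv,
      FreeGroup.lift_apply_of]
    split_ifs
    · simp
    · exact of_commute_conj x _)

open Classical in
theorem kill_of (S : Set X) (y : X) : kill S (of y) = if y ∈ S then 1 else of y := by
  unfold kill
  exact PresentedGroup.toGroup.of _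

theorem kill_kill (S T : Set X) (g : ReducedFreeGroup X) : kill S (kill T g) = kill (S ∪ T) g := by
  classical
  suffices (kill S).comp (kill T) = kill (S ∪ T) from DFunLike.congr_fun this g
  refine PresentedGroup.ext fun x => ?_
  change kill S (kill T (of x)) = kill (S ∪ T) (of x)
  rw [kill_of, kill_of]
  by_cases hT : x ∈ T
  · simp [hT]
  · simp [hT, kill_of]

theorem exists_finite_kill_eq_one (g : ReducedFreeGroup X) :
    ∃ S : Finset X, kill (S : Set X) g = 1 := by
  classical
  obtain ⟨w, rfl⟩ := mk_surjective g
  induction w using FreeGroup.induction_on with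
  | C1 => exact ⟨∅, by simp⟩
  | of x => exact ⟨{x}, by rw [mk_of, kill_of]; simp⟩
  | inv_of x _ => exact ⟨{x}, by rw [map_inv, mk_of, map_inv, kill_of]; simp⟩
  | mul a b ha hb =>
    obtain ⟨S, hS⟩ := ha
    obtain ⟨T, hT⟩ := hb
    refine ⟨S ∪ T, ?_⟩
    rw [map_mul, map_mul, Finset.coe_union, ← kill_kill _ _ (mk b), hT, Set.union_comm,
      ← kill_kill _ _ (mk a), hS]
    simp

/-- Only finitely many generators occur in g; killing them one by one fixes g and ends at 1. -/
theorem eq_one_of_forall_kill_singleton {g : ReducedFreeGroup X}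
    (h : ∀ x, kill {x} g = g) : g = 1 := by
  classical
  obtain ⟨S, hS⟩ := exists_finite_kill_eq_one g
  rw [← hS]
  clear hS
  induction S using Finset.induction_on with
  | empty =>
    suffices kill ((∅ : Finset X) : Set X) = MonoidHom.id _ by rw [this]; rfl
    refine PresentedGroup.ext fun x => ?_
    change kill _ (of x) = of x
    rw [kill_of]
    simp
  | insert x S _ ih =>
    rw [Finset.coe_insert, Set.insert_eq, ← kill_kill, ← ih, h]

open Classical in
/-- The iterated commutators `[y₁, [y₂, …, [yₖ, x]]]`. -/
noncomputable def iterComm (x : X) : List X → genClosure x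
  | [] => 1
  -- Words not ending in x all receive the value 1.
  | [z] => if z = x then ⟨of x, of_mem_genClosure x⟩ else 1
  | y :: z :: l => MulAut.conjNormal (of y) (iterComm x (z :: l)) * (iterComm x (z :: l))⁻¹

theorem iterComm_cons (x y : X) {l : List X} (hl : l ≠ []) :
    iterComm x (y :: l) = MulAut.conjNormal (of y) (iterComm x l) * (iterComm x l)⁻¹ := by
  obtain ⟨z, l, rfl⟩ := List.exists_cons_of_ne_nil hl
  rw [iterComm]

theorem iterComm_mem_genClosure (x : X) {y : X} {l : List X} (hy : y ∈ l) :
    (iterComm x l : ReducedFreeGroup X) ∈ genClosure y := by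
  classical
  induction l with
  | nil => simp at hy
  | cons z l ih =>
    rcases eq_or_ne l [] with rfl | hl
    · obtain rfl : y = z := by simpa using hy
      rw [iterComm]
      split_ifs with h
      · subst h; exact of_mem_genClosure y
      · exact one_mem _
    · rw [iterComm_cons x z hl, Subgroup.coe_mul, MulAut.conjNormal_apply, Subgroup.coe_inv]
      rcases List.mem_cons.1 hy with rfl | hy
      · rw [mul_assoc, mul_assoc, ← mul_assoc _ (of y)⁻¹]
        refine mul_mem (of_mem_genClosure y) ?_
        exact (inferInstance : (genClosure y).Normal).conj_mem _
          (inv_mem (of_mem_genClosure y)) _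
      · exact mul_mem ((inferInstance : (genClosure y).Normal).conj_mem _ (ih hy) _)
          (inv_mem (ih hy))

/-- A word containing y has its value in the abelian normal closure of y, on which conjugation by y
is trivial. This matches `prepend` killing words with a repeated letter. -/
theorem iterComm_eq_one_of_not_nodup (x : X) {l : List X} (hl : ¬ l.Nodup) : iterComm x l = 1 := by
  induction l with
  | nil => simp at hl
  | cons y l ih =>
    rcases eq_or_ne l [] with rfl | hne
    · simp at hl
    rw [iterComm_cons x y hne]
    by_cases hy : y ∈ l
    · rw [mul_inv_eq_one]
      refine Subtype.ext ?_
      rw [MulAut.conjNormal_apply]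
      exact of_commute_of_mem_genClosure (iterComm_mem_genClosure x hy)
    · rw [ih fun h => hl (List.nodup_cons.2 ⟨hy, h⟩), map_one, inv_one, one_mul]

open Finsupp

/-- The linear extension of the iterated commutators. -/
noncomputable def commMap (x : X) : (List X →₀ ℤ) →+ Additive (genClosure x) :=
  Finsupp.liftAddHom fun l => zmultiplesHom _ (Additive.ofMul (iterComm x l))

theorem commMap_single (x : X) (l : List X) (c : ℤ) :
    commMap x (single l c) = c • Additive.ofMul (iterComm x l) := by
  rw [commMap, liftAddHom_apply_single, zmultiplesHom_apply]

/-- Conjugation on the normal closure of a generator, in additive notation. -/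
noncomputable def conjAdd (x : X) (g : ReducedFreeGroup X) :
    Additive (genClosure x) →+ Additive (genClosure x) :=
  MonoidHom.toAdditive (MulAut.conjNormal (H := genClosure x) g).toMonoidHom

/-- Prepending y corresponds to conjugation by y minus the identity, except at the empty word, which
the last term corrects. -/
theorem commMap_prepend (x y : X) (v : List X →₀ ℤ) :
    commMap x (prepend ℤ List.Nodup y v) =
      conjAdd x (of y) (commMap x v) - commMap x v + v [] • Additive.ofMul (iterComm x [y]) := by
  classical
  induction v using Finsupp.induction_linear with
  | zero => simp
  | add v w hv hw =>
    rw [map_add, map_add, map_add, map_add, hv, hw, Finsupp.add_apply, add_smul]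
    abel
  | single l c =>
    have h1 : commMap x (prepend ℤ List.Nodup y (single l c)) =
        c • Additive.ofMul (iterComm x (y :: l)) := by
      rw [prepend_single]
      split_ifs with h
      · rw [commMap_single]
      · rw [map_zero, iterComm_eq_one_of_not_nodup x h, ofMul_one, smul_zero]
    rw [h1, commMap_single, map_zsmul]
    rcases eq_or_ne l [] with rfl | hl
    · rw [single_eq_same, show iterComm x [] = 1 from rfl, ofMul_one, map_zero, smul_zero,
        sub_zero, zero_add]
    · rw [single_eq_of_ne hl.symm, zero_smul, add_zero, iterComm_cons x y hl, ← smul_sub,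
        sub_eq_add_neg]
      rfl

theorem iterComm_singleton (x y : X) :
    (iterComm x [y] : ReducedFreeGroup X) = of y * (kill {x} (of y))⁻¹ := by
  classical
  rw [iterComm, kill_of]
  by_cases h : y = x
  · subst h; simp
  · simp [h]

/-- The value of `commMap` on the orbit of the empty word. -/
noncomputable def foxValue (x : X) (g : FreeGroup X) : ReducedFreeGroup X :=
  ((commMap x ((nodupRep ℤ g : Module.End ℤ (List X →₀ ℤ)) (single [] 1))).toMul : genClosure x)

theorem foxValue_of_mul (x y : X) (g : FreeGroup X) :
    foxValue x (FreeGroup.of y * g) =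
      of y * foxValue x g * (of y)⁻¹ * (of y * (kill {x} (of y))⁻¹) := by
  unfold foxValue
  rw [magnusRep_mul_apply, magnusRep_of_apply, map_add, commMap_prepend,
    magnusRep_apply_single_nil, one_smul, ← add_assoc, add_sub_cancel, toMul_add,
    Subgroup.coe_mul, toMul_ofMul, iterComm_singleton]
  rfl

/-- Both sides obey the same recursion under left multiplication by a generator and agree at 1. -/
theorem foxValue_eq (x : X) (g : FreeGroup X) :
    foxValue x g = mk g * (kill {x} (mk g))⁻¹ := by
  have hof : ∀ y h, foxValue x (FreeGroup.of y * h) =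
      mk (FreeGroup.of y * h) * (kill {x} (mk (FreeGroup.of y * h)))⁻¹ ↔
      foxValue x h = mk h * (kill {x} (mk h))⁻¹ := by
    intro y h
    rw [foxValue_of_mul, map_mul, map_mul, mk_of, mul_inv_rev,
      show of y * foxValue x h * (of y)⁻¹ * (of y * (kill {x} (of y))⁻¹) =
        of y * (foxValue x h * (kill {x} (of y))⁻¹) by group, mul_assoc, mul_right_inj,
      ← mul_assoc, mul_left_inj]
  -- An equivalence, so that the case of an inverse generator follows from that of the generator.
  have key : ∀ h, foxValue x (g * h) = mk (g * h) * (kill {x} (mk (g * h)))⁻¹ ↔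
      foxValue x h = mk h * (kill {x} (mk h))⁻¹ := by
    induction g using FreeGroup.induction_on with
    | C1 => intro h; rw [one_mul]
    | of y => exact hof y
    | inv_of y _ => intro h; rw [← hof y, mul_inv_cancel_left]
    | mul a b ha hb => intro h; rw [mul_assoc, ha, hb]
  have := (key 1).2 (by
    unfold foxValue
    rw [map_one, Units.val_one, Module.End.one_apply, commMap_single]
    simp [iterComm])
  rwa [mul_one] at this

/-- If g fixes the empty word, every `foxValue` is 1, so g is unchanged by killing any one
generator. -/
theorem mk_eq_one_of_nodupRep {g : FreeGroup X}
    (hg : (nodupRep ℚ g : Module.End ℚ (List X →₀ ℚ)) (single [] 1) = single [] 1) :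
    mk g = 1 := by
  have hZ : (nodupRep ℤ g : Module.End ℤ (List X →₀ ℤ)) (single [] 1) = single [] 1 := by
    apply mapRange_injective (Int.castRingHom ℚ) (map_zero _) Int.cast_injective
    rw [map_nodupRep_apply, mapRange_single, map_one, hg]
  refine eq_one_of_forall_kill_singleton fun x => ?_
  have h := foxValue_eq x g
  unfold foxValue at h
  rw [hZ, commMap_single] at h
  simp only [iterComm, ofMul_one, smul_zero, toMul_zero, Subgroup.coe_one] at h
  exact (mul_inv_eq_one.1 h.symm).symm

variable (X) in
/-- The Magnus-type representation of the reduced free group. -/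
noncomputable def magnusRep : ReducedFreeGroup X →* (Module.End ℚ (List X →₀ ℚ))ˣ :=
  PresentedGroup.toGroup (f := onePlusPrepend ℚ not_nodup_cons_cons) (by
    rintro _ ⟨x, g, rfl⟩
    exact nodupRep_relation g x)

theorem magnusRep_of (x : X) : magnusRep X (of x) = onePlusPrepend ℚ not_nodup_cons_cons x := by
  unfold magnusRep
  exact PresentedGroup.toGroup.of _

variable (X) in
theorem isAugSeparated : IsAugSeparated (ReducedFreeGroup X) := by
  refine isAugSeparated_of_magnusRep not_nodup_cons_cons mk mk_surjective (magnusRep X) ?_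
    fun g => mk_eq_one_of_nodupRep
  refine FreeGroup.ext_hom _ _ fun x => ?_
  rw [MonoidHom.comp_apply, mk_of, magnusRep_of, _root_.magnusRep, FreeGroup.lift_apply_of]

end ReducedFreeGroup

theorem IsReducedFreeGroup.isAugSeparated {L : Type u} [Group L] (hL : IsReducedFreeGroup L) :
    IsAugSeparated L := by
  obtain ⟨X, ⟨e⟩⟩ := hL
  exact (ReducedFreeGroup.isAugSeparated X).of_mulEquiv e

/-! ### Conclusion. -/

theorem mainTheorem2 (G : Type u) [Group G]
    (hG : IsAlmostDirectProductOf (fun (L : Type u) [Group L] => IsFreeGroup L) G ∨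
      IsAlmostDirectProductOf (fun (L : Type u) [Group L] => IsReducedFreeGroup L) G) :
    IsResiduallyNilpotent G ∧
    ¬ HasGeneralizedTorsion G ∧
    (∀ g : G, g ≠ 1 → ¬ IsOfFinOrder g) ∧
    ∃ (D : Type u) (_ : DivisionRing D) (_ : Algebra ℚ D) (f : MonoidAlgebra ℤ G →+* D),
      Function.Injective f := by
  obtain ⟨hres, C, hC⟩ : IsResiduallyNilpotent G ∧ ∃ C : Set G, IsPositiveCone C := by
    rcases hG with hG | hG
    · exact hG.isResiduallyNilpotent_and_exists_isPositiveCone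
        fun L _ hL => @IsFreeGroup.isAugSeparated L _ hL
    · exact hG.isResiduallyNilpotent_and_exists_isPositiveCone
        fun L _ hL => hL.isAugSeparated
  have htor := not_hasGeneralizedTorsion_of_isPositiveCone hC
  exact ⟨hres, htor, fun g hg => not_isOfFinOrder_of_not_hasGeneralizedTorsion htor hg,
    hC.exists_embedding⟩
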